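/- Let $\mathcal H_\infty$ on $L^2(0,\infty)$ and $\mathcal H_1$ on $L^2(0,1)$ be the bounded Hardy operators $f\mapsto\frac1x\int_0^x f(t)\,dt$, with Hilbert space adjoints $\mathcal H_\infty^*$ and $\mathcal H_1^*$, and regard $L^2(0,1)$ as a subspace of $L^2(0,\infty)$ by extending functions by zero. Let $L^2(i\mathbb R)$ be the $L^2$ space of the imaginary axis with respect to the measure $d\beta$ at the point $i\beta$, let $\phi(s)=\frac{s-\frac12}{s+\frac12}$, and let $M_\phi g=\phi g$ on $L^2(i\mathbb R)$. Let $H^2_+(i\mathbb R)\subset L^2(i\mathbb R)$ be the space of boundary functions $F(i\beta)=\lim_{x\to0^+}F(x+i\beta)$ (for almost every $\beta$) of the analytic functions $F$ on $\{\operatorname{Re}z>0\}$ with $\sup_{x>0}\int_{-\infty}^\infty|F(x+iy)|^2\,dy<\infty$. The modified Mellin transform $$(\mathcal Qf)(i\beta)=\frac1{\sqrt{2\pi}}\int_0^\infty f(t)\,t^{i\beta-\frac12}\,dt,$$ understood as the limit in $L^2(i\mathbb R)$, as $R\to\infty$, of the integrals over $[1/R,R]$, is a well-defined isometric isomorphism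 from $L^2(0,\infty)$ onto $L^2(i\mathbb R)$, and the following hold. 1. $\mathcal Q(I-\mathcal H_\infty^*)=M_\phi\mathcal Q$ on $L^2(0,\infty)$; in particular $I-\mathcal H_\infty^*$ on $L^2(0,\infty)$ is unitarily equivalent to $M_\phi$ on $L^2(i\mathbb R)$. 2. $L^2(0,1)$ is invariant under $I-\mathcal H_\infty^*$, with $(I-\mathcal H_\infty^*)|_{L^2(0,1)}=I-\mathcal H_1^*$; $H^2_+(i\mathbb R)$ is invariant under $M_\phi$; and $\mathcal Q$ restricts to an isometric isomorphism from $L^2(0,1)$ onto $H^2_+(i\mathbb R)$ with $\mathcal Q(I-\mathcal H_1^*)f=M_\phi\mathcal Qf$ for all $f\in L^2(0,1)$. In particular $I-\mathcal H_1^*$ on $L^2(0,1)$ is unitarily equivalent to $M_\phi$ on $H^2_+(i\mathbb R)$. 3. The map $V:L^2(0,\infty)\to L^2(i\mathbb R)$, $(Vf)(i\beta)=(\mathcal Qf)(-i\beta)$, is an isometric isomorphism with $V(I-\mathcal H_\infty)=M_\phi V$; in particular $I-\mathcal H_\infty$ on $L^2(0,\infty)$ is unitarily equivalent to $M_\phi$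 on $L^2(i\mathbb R)$. -/

import Mathlib

open MeasureTheory Set Filter Topology
open scoped ENNReal

noncomputable section

namespace HardyMellin

/-! ### The Hardy operators -/

/-- Hardy's inequality, in the form that makes the Hardy operators bounded on `L²`. -/
theorem hardy_lintegral (g : ℝ → ℝ≥0∞) (hg : Measurable g) :
    ∫⁻ x in Ioi (0 : ℝ), (ENNReal.ofReal x⁻¹ * ∫⁻ t in Ioc 0 x, g t) ^ 2
      ≤ 4 * ∫⁻ t in Ioi (0 : ℝ), g t ^ 2 := by
  have hw : Measurable fun t : ℝ => ENNReal.ofReal (t ^ (1 / 2 : ℝ)) * g t ^ 2 := by fun_prop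
  have cs : ∀ x ∈ Ioi (0 : ℝ), (ENNReal.ofReal x⁻¹ * ∫⁻ t in Ioc 0 x, g t) ^ 2 ≤
      ∫⁻ t in Ioi (0 : ℝ), (Iic x).indicator
        (fun t => ENNReal.ofReal (2 * x ^ (-3 / 2 : ℝ)) *
          (ENNReal.ofReal (t ^ (1 / 2 : ℝ)) * g t ^ 2)) t := by
    intro x hx
    have hx : 0 < x := hx
    have h1 : (∫⁻ t in Ioc 0 x, g t) =
        ∫⁻ t in Ioc 0 x, ((fun t : ℝ => ENNReal.ofReal (t ^ (-1 / 4 : ℝ))) *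
          (fun t : ℝ => ENNReal.ofReal (t ^ (1 / 4 : ℝ)) * g t)) t := by
      refine setLIntegral_congr_fun measurableSet_Ioc fun t ht => ?_
      have ht0 : 0 < t := ht.1
      simp only [Pi.mul_apply]
      rw [← mul_assoc, ← ENNReal.ofReal_mul (by positivity), ← Real.rpow_add ht0]
      norm_num
    have h2 := ENNReal.lintegral_mul_le_Lp_mul_Lq (volume.restrict (Ioc 0 x))
      Real.HolderConjugate.two_two
      (f := fun t : ℝ => ENNReal.ofReal (t ^ (-1 / 4 : ℝ)))
      (g := fun t : ℝ => ENNReal.ofReal (t ^ (1 / 4 : ℝ)) * g t) (by fun_prop) (by fun_prop)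
    have hA : ∫⁻ t in Ioc 0 x, (ENNReal.ofReal (t ^ (-1 / 4 : ℝ))) ^ (2 : ℝ) =
        ENNReal.ofReal (2 * x ^ (1 / 2 : ℝ)) := by
      have : ∫⁻ t in Ioc 0 x, (ENNReal.ofReal (t ^ (-1 / 4 : ℝ))) ^ (2 : ℝ) =
          ∫⁻ t in Ioc 0 x, ENNReal.ofReal (t ^ (-1 / 2 : ℝ)) := by
        refine setLIntegral_congr_fun measurableSet_Ioc fun t ht => ?_
        have ht0 : 0 < t := ht.1
        rw [ENNReal.ofReal_rpow_of_nonneg (by positivity) (by norm_num), ← Real.rpow_mul ht0.le]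
        norm_num
      rw [this, ← ofReal_integral_eq_lintegral_ofReal]
      · rw [← intervalIntegral.integral_of_le hx.le, integral_rpow (by norm_num)]
        congr 1
        norm_num
        ring
      · rw [← IntegrableOn, ← intervalIntegrable_iff_integrableOn_Ioc_of_le hx.le]
        exact intervalIntegral.intervalIntegrable_rpow' (by norm_num)
      · filter_upwards [ae_restrict_mem measurableSet_Ioc] with t ht
        exact Real.rpow_nonneg ht.1.le _
    have hB : ∫⁻ t in Ioc 0 x, (ENNReal.ofReal (t ^ (1 / 4 : ℝ)) * g t) ^ (2 : ℝ) =
        ∫⁻ t in Ioc 0 x, ENNReal.ofReal (t ^ (1 / 2 : ℝ)) * g t ^ 2 := by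
      refine setLIntegral_congr_fun measurableSet_Ioc fun t ht => ?_
      have ht0 : 0 < t := ht.1
      rw [ENNReal.mul_rpow_of_nonneg _ _ (by norm_num),
        ENNReal.ofReal_rpow_of_nonneg (by positivity) (by norm_num), ← Real.rpow_mul ht0.le]
      norm_num
    rw [hA, hB, ← h1] at h2
    have h3 : (∫⁻ t in Ioc 0 x, g t) ^ 2 ≤ ENNReal.ofReal (2 * x ^ (1 / 2 : ℝ)) *
        ∫⁻ t in Ioc 0 x, ENNReal.ofReal (t ^ (1 / 2 : ℝ)) * g t ^ 2 := by
      refine (pow_le_pow_left' h2 2).trans_eq ?_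
      rw [mul_pow, ← ENNReal.rpow_natCast, ← ENNReal.rpow_natCast, ← ENNReal.rpow_mul,
        ← ENNReal.rpow_mul]
      norm_num
    rw [setLIntegral_indicator measurableSet_Iic, inter_comm, Ioi_inter_Iic,
      lintegral_const_mul _ hw, mul_pow]
    refine (mul_le_mul_right h3 _).trans_eq ?_
    rw [← mul_assoc, ← ENNReal.ofReal_pow (by positivity), ← ENNReal.ofReal_mul (by positivity)]
    congr 2
    have : x ^ (-3 / 2 : ℝ) = x⁻¹ ^ 2 * x ^ (1 / 2 : ℝ) := by
      rw [← Real.rpow_neg_one, ← Real.rpow_natCast, ← Real.rpow_mul hx.le, ← Real.rpow_add hx]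
      norm_num
    rw [this]; ring
  have hmeas : Measurable (Function.uncurry fun (x t : ℝ) => (Iic x).indicator
        (fun t => ENNReal.ofReal (2 * x ^ (-3 / 2 : ℝ)) *
          (ENNReal.ofReal (t ^ (1 / 2 : ℝ)) * g t ^ 2)) t) := by
    have : (Function.uncurry fun (x t : ℝ) => (Iic x).indicator
        (fun t => ENNReal.ofReal (2 * x ^ (-3 / 2 : ℝ)) *
          (ENNReal.ofReal (t ^ (1 / 2 : ℝ)) * g t ^ 2)) t) =
        {p : ℝ × ℝ | p.2 ≤ p.1}.indicator fun p =>
          ENNReal.ofReal (2 * p.1 ^ (-3 / 2 : ℝ)) *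
          (ENNReal.ofReal (p.2 ^ (1 / 2 : ℝ)) * g p.2 ^ 2) := by
      ext ⟨x, t⟩
      simp [Function.uncurry, indicator]
    rw [this]
    refine Measurable.indicator (by fun_prop) (measurableSet_le measurable_snd measurable_fst)
  refine (setLIntegral_mono' measurableSet_Ioi cs).trans ?_
  rw [lintegral_lintegral_swap hmeas.aemeasurable, ← lintegral_const_mul _ (by fun_prop)]
  refine setLIntegral_mono' measurableSet_Ioi fun t ht => ?_
  have ht : 0 < t := ht
  have e1 : ∀ x : ℝ, (Iic x).indicator (fun t => ENNReal.ofReal (2 * x ^ (-3 / 2 : ℝ)) *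
          (ENNReal.ofReal (t ^ (1 / 2 : ℝ)) * g t ^ 2)) t =
      (Ici t).indicator (fun x => ENNReal.ofReal (2 * x ^ (-3 / 2 : ℝ)) *
          (ENNReal.ofReal (t ^ (1 / 2 : ℝ)) * g t ^ 2)) x := by
    intro x; simp [indicator]
  simp_rw [e1]
  rw [setLIntegral_indicator measurableSet_Ici, inter_eq_left.2 (Ici_subset_Ioi.2 ht),
    lintegral_mul_const _ (by fun_prop), setLIntegral_congr Ioi_ae_eq_Ici.symm,
    ← ofReal_integral_eq_lintegral_ofReal, integral_const_mul,
    integral_Ioi_rpow_of_lt (by norm_num) ht, ← mul_assoc, ← ENNReal.ofReal_mul]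
  · have : 2 * (-t ^ (-3 / 2 + 1 : ℝ) / (-3 / 2 + 1)) * t ^ (1 / 2 : ℝ) = 4 := by
      have : t ^ (-3 / 2 + 1 : ℝ) * t ^ (1 / 2 : ℝ) = 1 := by
        rw [← Real.rpow_add ht]; norm_num
      linear_combination 4 * this
    rw [this]; simp
  · have := Real.rpow_nonneg ht.le (-3 / 2 + 1 : ℝ)
    have e : 2 * (-t ^ (-3 / 2 + 1 : ℝ) / (-3 / 2 + 1)) = 4 * t ^ (-3 / 2 + 1 : ℝ) := by ring
    rw [e]; positivity
  · exact (integrableOn_Ioi_rpow_of_lt (by norm_num) ht).const_mul _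
  · filter_upwards [ae_restrict_mem measurableSet_Ioi] with x hx
    have : 0 < x := ht.trans hx
    positivity

/-- The two cases of interest are `S = (0, 1)` and `S = (0, ∞)`. -/
structure IsInitial (S : Set ℝ) : Prop where
  meas : MeasurableSet S
  pos : S ⊆ Ioi 0
  initial : ∀ x ∈ S, Ioc 0 x ⊆ S

theorem isInitial_Ioi : IsInitial (Ioi 0) :=
  ⟨measurableSet_Ioi, subset_rfl, fun _ _ _ ht => ht.1⟩

theorem isInitial_Ioo : IsInitial (Ioo 0 1) :=
  ⟨measurableSet_Ioo, fun _ h => h.1, fun _ hx _ ht => ⟨ht.1, ht.2.trans_lt hx.2⟩⟩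

theorem intervalIntegrable_of_memLp {S : Set ℝ} (hS : IsInitial S) {f : ℝ → ℂ}
    (hf : MemLp f 2 (volume.restrict S)) {x : ℝ} (hx : x ∈ S) :
    IntervalIntegrable f volume 0 x := by
  have hx0 : 0 < x := hS.pos hx
  rw [intervalIntegrable_iff_integrableOn_Ioc_of_le hx0.le]
  have : MemLp f 2 (volume.restrict (Ioc 0 x)) :=
    hf.mono_measure (Measure.restrict_mono_set _ (hS.initial x hx))
  exact this.integrable (by norm_num)

/-- The average `x ↦ (1/x) ∫₀ˣ f(t) dt`. -/
def average (f : ℝ → ℂ) (x : ℝ) : ℂ := (x : ℂ)⁻¹ * ∫ t in (0 : ℝ)..x, f t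

theorem average_congr {S : Set ℝ} (hS : IsInitial S) {f g : ℝ → ℂ}
    (h : f =ᵐ[volume.restrict S] g) {x : ℝ} (hx : x ∈ S) : average f x = average g x := by
  have hx0 : 0 < x := hS.pos hx
  unfold average
  rw [intervalIntegral.integral_of_le hx0.le, intervalIntegral.integral_of_le hx0.le,
    integral_congr_ae (ae_mono (Measure.restrict_mono_set _ (hS.initial x hx)) h)]

theorem average_bound {S : Set ℝ} (hS : IsInitial S) {f : ℝ → ℂ}
    (hf : StronglyMeasurable f) :
    AEStronglyMeasurable (average f) (volume.restrict S) ∧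
    eLpNorm (average f) 2 (volume.restrict S) ≤ 2 * eLpNorm f 2 (volume.restrict S) := by
  constructor
  · have h : StronglyMeasurable fun x : ℝ => (x : ℂ)⁻¹ * ∫ t,
        ({p : ℝ × ℝ | 0 < p.2 ∧ p.2 ≤ p.1}.indicator fun p => f p.2) (x, t) := by
      refine StronglyMeasurable.mul
        (Complex.measurable_ofReal.inv.stronglyMeasurable) ?_
      refine StronglyMeasurable.integral_prod_right' ?_
      exact (hf.comp_measurable measurable_snd).indicator
        ((measurableSet_lt measurable_const measurable_snd).inter
          (measurableSet_le measurable_snd measurable_fst))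
    refine h.aestronglyMeasurable.congr ?_
    filter_upwards [ae_restrict_mem hS.meas] with x hx
    have hx0 : 0 < x := hS.pos hx
    unfold average
    rw [intervalIntegral.integral_of_le hx0.le, ← integral_indicator measurableSet_Ioc]
    rfl
  · have key := hardy_lintegral (S.indicator fun t => ‖f t‖ₑ) (hf.enorm.indicator hS.meas)
    have r : ∫⁻ t in Ioi (0 : ℝ), (S.indicator (fun t => ‖f t‖ₑ) t) ^ 2 =
        ∫⁻ t in S, ‖f t‖ₑ ^ 2 := by
      have : (fun t => (S.indicator (fun t => ‖f t‖ₑ) t) ^ 2) =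
          S.indicator (fun t => ‖f t‖ₑ ^ 2) := by
        ext t; by_cases h : t ∈ S <;> simp [h]
      rw [this, setLIntegral_indicator hS.meas, inter_eq_left.2 hS.pos]
    have l : ∫⁻ x in S, ‖average f x‖ₑ ^ 2 ≤ ∫⁻ x in Ioi (0 : ℝ),
        (ENNReal.ofReal x⁻¹ * ∫⁻ t in Ioc 0 x, S.indicator (fun t => ‖f t‖ₑ) t) ^ 2 := by
      refine le_trans ?_ (lintegral_mono_set hS.pos)
      refine setLIntegral_mono' hS.meas fun x hx => ?_
      have hx0 : 0 < x := hS.pos hx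
      gcongr
      have e : ∫⁻ t in Ioc 0 x, S.indicator (fun t => ‖f t‖ₑ) t = ∫⁻ t in Ioc 0 x, ‖f t‖ₑ :=
        setLIntegral_congr_fun measurableSet_Ioc fun t ht => by
          simp [hS.initial x hx ht]
      rw [e, average, intervalIntegral.integral_of_le hx0.le, enorm_mul]
      gcongr
      · rw [← Complex.ofReal_inv, ← ofReal_norm, Complex.norm_real,
          Real.norm_of_nonneg (by positivity)]
      · exact enorm_integral_le_lintegral_enorm _
    rw [r] at key
    have key := l.trans key
    rw [eLpNorm_eq_lintegral_rpow_enorm_toReal (by norm_num) (by norm_num),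
      eLpNorm_eq_lintegral_rpow_enorm_toReal (by norm_num) (by norm_num)]
    simp only [ENNReal.toReal_ofNat, ENNReal.rpow_ofNat]
    refine (ENNReal.rpow_le_rpow key (by norm_num)).trans_eq ?_
    rw [ENNReal.mul_rpow_of_nonneg _ _ (by norm_num)]
    congr 1
    rw [show (4 : ℝ≥0∞) = 2 ^ (2 : ℝ) by norm_num, ← ENNReal.rpow_mul]
    norm_num

theorem memLp_average {S : Set ℝ} (hS : IsInitial S) (f : Lp ℂ 2 (volume.restrict S)) :
    MemLp (average f) 2 (volume.restrict S) := by
  obtain ⟨h1, h2⟩ := average_bound hS (Lp.stronglyMeasurable f)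
  exact ⟨h1, h2.trans_lt (ENNReal.mul_lt_top (by norm_num) (Lp.memLp f).2)⟩

/-- The operator `(H f)(x) = (1/x) ∫₀ˣ f(t) dt` on `L²(S)`. -/
def hardy (S : Set ℝ) (hS : IsInitial S) :
    Lp ℂ 2 (volume.restrict S) →L[ℂ] Lp ℂ 2 (volume.restrict S) :=
  LinearMap.mkContinuous
    { toFun := fun f => (memLp_average hS f).toLp (average f)
      map_add' := fun f g => by
        rw [← MemLp.toLp_add]
        refine MemLp.toLp_congr _ _ ?_
        filter_upwards [ae_restrict_mem hS.meas] with x hx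
        rw [average_congr hS (Lp.coeFn_add f g) hx]
        simp only [average, Pi.add_apply]
        rw [intervalIntegral.integral_add (intervalIntegrable_of_memLp hS (Lp.memLp f) hx)
          (intervalIntegrable_of_memLp hS (Lp.memLp g) hx), mul_add]
      map_smul' := fun c f => by
        rw [RingHom.id_apply, ← MemLp.toLp_const_smul]
        refine MemLp.toLp_congr _ _ ?_
        filter_upwards [ae_restrict_mem hS.meas] with x hx
        rw [average_congr hS (Lp.coeFn_smul c f) hx]
        simp only [average, Pi.smul_apply, smul_eq_mul]
        rw [intervalIntegral.integral_const_mul]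
        ring }
    2 (fun f => by
      simp only [LinearMap.coe_mk, AddHom.coe_mk]
      rw [Lp.norm_toLp, Lp.norm_def, ← ENNReal.toReal_ofNat 2, ← ENNReal.toReal_mul]
      exact ENNReal.toReal_mono (ENNReal.mul_lt_top (by norm_num) (Lp.memLp f).2).ne
        (average_bound hS (Lp.stronglyMeasurable f)).2)

/-- `L²(0, ∞)`. -/
abbrev L2Inf : Type := Lp ℂ 2 (volume.restrict (Ioi (0 : ℝ)))

/-- `L²(0, 1)`. -/
abbrev L2One : Type := Lp ℂ 2 (volume.restrict (Ioo (0 : ℝ) 1))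

/-- The infinite Hardy operator on `L²(0, ∞)`. -/
def hardyInf : L2Inf →L[ℂ] L2Inf := hardy (Ioi 0) isInitial_Ioi

/-- The finite Hardy operator on `L²(0, 1)`. -/
def hardyOne : L2One →L[ℂ] L2One := hardy (Ioo 0 1) isInitial_Ioo

theorem eLpNorm_extend (f : ℝ → ℂ) :
    eLpNorm ((Ioo (0 : ℝ) 1).indicator f) 2 (volume.restrict (Ioi (0 : ℝ))) =
      eLpNorm f 2 (volume.restrict (Ioo (0 : ℝ) 1)) := by
  rw [eLpNorm_indicator_eq_eLpNorm_restrict measurableSet_Ioo,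
    Measure.restrict_restrict measurableSet_Ioo, inter_eq_left.2 (fun _ h => h.1)]

theorem memLp_extend (f : L2One) :
    MemLp ((Ioo (0 : ℝ) 1).indicator f) 2 (volume.restrict (Ioi (0 : ℝ))) :=
  ⟨((Lp.stronglyMeasurable f).indicator measurableSet_Ioo).aestronglyMeasurable,
    (eLpNorm_extend f).trans_lt (Lp.memLp f).2⟩

theorem extend_congr {f g : ℝ → ℂ} (h : f =ᵐ[volume.restrict (Ioo (0 : ℝ) 1)] g) :
    (Ioo (0 : ℝ) 1).indicator f =ᵐ[volume.restrict (Ioi (0 : ℝ))] (Ioo (0 : ℝ) 1).indicator g := by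
  refine ae_restrict_of_ae ?_
  filter_upwards [(ae_restrict_iff' measurableSet_Ioo).1 h] with x hx
  by_cases hm : x ∈ Ioo (0 : ℝ) 1
  · simp [hm, hx hm]
  · simp [hm]

/-- The inclusion of `L²(0, 1)` in `L²(0, ∞)`: extension by zero. -/
def extendZero : L2One →ₗᵢ[ℂ] L2Inf where
  toFun f := (memLp_extend f).toLp _
  map_add' f g := by
    rw [← MemLp.toLp_add]
    refine MemLp.toLp_congr _ _ ((extend_congr (Lp.coeFn_add f g)).trans ?_)
    rw [indicator_add']
  map_smul' c f := by
    rw [RingHom.id_apply, ← MemLp.toLp_const_smul]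
    refine MemLp.toLp_congr _ _ ((extend_congr (Lp.coeFn_smul c f)).trans ?_)
    exact Eventually.of_forall fun x => by by_cases h : x ∈ Ioo (0 : ℝ) 1 <;> simp [indicator, h]
  norm_map' f := by
    simp only [LinearMap.coe_mk, AddHom.coe_mk]
    rw [Lp.norm_toLp, eLpNorm_extend, Lp.norm_def]

/-! ### The imaginary axis -/

/-- Lebesgue measure `dβ` on the imaginary axis `{iβ : β ∈ ℝ}`, as a measure on `ℂ`. -/
def imagAxis : Measure ℂ := Measure.map (fun β : ℝ => (β : ℂ) * Complex.I) volume

/-- `L²(iℝ)`. -/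
abbrev L2Imag : Type := Lp ℂ 2 imagAxis

/-- `f ∈ L²(0, ∞)` has modified Mellin transform `g ∈ L²(iℝ)`, that is
`g(s) = (2π)^{-1/2} ∫₀^∞ f(t) t^{s - 1/2} dt` for `s ∈ iℝ`. For general `f ∈ L²(0, ∞)` the
integral does not converge absolutely; as usual for Fourier-type integrals on `L²`, it is the
`L²(iℝ)`-limit of the integrals over `[1/R, R]` as `R → ∞`. -/
def IsMellinTransform (f : L2Inf) (g : L2Imag) : Prop :=
  Tendsto (fun R : ℝ => eLpNorm (fun s : ℂ => g s -
      ((Real.sqrt (2 * Real.pi) : ℝ) : ℂ)⁻¹ *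
        ∫ t in R⁻¹..R, f t * (t : ℂ) ^ (s - 1 / 2)) 2 imagAxis)
    atTop (𝓝 0)

/-- `φ(s) = (s - 1/2) / (s + 1/2)`. -/
def phi (s : ℂ) : ℂ := (s - 1 / 2) / (s + 1 / 2)

theorem measurable_phi : Measurable phi := by
  unfold phi; fun_prop

theorem norm_phi (β : ℝ) : ‖phi ((β : ℂ) * Complex.I)‖ = 1 := by
  have h : ‖(β : ℂ) * Complex.I - 1 / 2‖ = ‖(β : ℂ) * Complex.I + 1 / 2‖ := by
    rw [Complex.norm_def, Complex.norm_def]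
    congr 1
    simp [Complex.normSq_apply]
  have h0 : (β : ℂ) * Complex.I + 1 / 2 ≠ 0 := fun h => by
    have := congrArg Complex.re h
    simp at this
  rw [phi, norm_div, h, div_self (norm_ne_zero_iff.2 h0)]

theorem memLp_phi : MemLp phi ∞ imagAxis := by
  refine memLp_top_of_bound measurable_phi.aestronglyMeasurable 1 ?_
  rw [imagAxis, ae_map_iff (by fun_prop) (measurableSet_le measurable_phi.norm measurable_const)]
  exact Eventually.of_forall fun β => (norm_phi β).le

/-- The multiplication operator `M_φ g = φ g` on `L²(iℝ)`. -/
def mulPhi : L2Imag →L[ℂ] L2Imag :=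
  (ContinuousLinearMap.mul ℂ ℂ).holderL imagAxis ∞ 2 2 (memLp_phi.toLp phi)

/-- `F` belongs to the Hardy space `H²` of the right half plane `{Re z > 0}`. -/
def IsHardyFunction (F : ℂ → ℂ) : Prop :=
  DifferentiableOn ℂ F {z : ℂ | 0 < z.re} ∧
    (⨆ (x : ℝ) (_ : 0 < x), ∫⁻ y : ℝ, ‖F ((x : ℂ) + (y : ℂ) * Complex.I)‖ₑ ^ 2) < ∞

theorem IsHardyFunction.add {F G : ℂ → ℂ} (hF : IsHardyFunction F) (hG : IsHardyFunction G) :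
    IsHardyFunction (F + G) := by
  refine ⟨hF.1.add hG.1, ?_⟩
  refine lt_of_le_of_lt ?_ (ENNReal.add_lt_top.2
    ⟨ENNReal.mul_lt_top (by norm_num : (2 : ℝ≥0∞) < ∞) hF.2,
      ENNReal.mul_lt_top (by norm_num : (2 : ℝ≥0∞) < ∞) hG.2⟩)
  refine iSup₂_le fun x hx => ?_
  have hm : Measurable fun y : ℝ => ‖F ((x : ℂ) + (y : ℂ) * Complex.I)‖ₑ ^ 2 := by
    have : Continuous fun y : ℝ => F ((x : ℂ) + (y : ℂ) * Complex.I) :=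
      hF.1.continuousOn.comp_continuous (by fun_prop) (fun y => by simpa using hx)
    exact (this.measurable.enorm).pow_const 2
  calc ∫⁻ y : ℝ, ‖(F + G) ((x : ℂ) + (y : ℂ) * Complex.I)‖ₑ ^ 2
      ≤ ∫⁻ y : ℝ, (2 * ‖F ((x : ℂ) + (y : ℂ) * Complex.I)‖ₑ ^ 2 +
          2 * ‖G ((x : ℂ) + (y : ℂ) * Complex.I)‖ₑ ^ 2) := by
        refine lintegral_mono fun y => ?_
        refine (pow_le_pow_left' (enorm_add_le _ _) 2).trans ?_
        have := ENNReal.rpow_add_le_mul_rpow_add_rpow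
          ‖F ((x : ℂ) + (y : ℂ) * Complex.I)‖ₑ ‖G ((x : ℂ) + (y : ℂ) * Complex.I)‖ₑ
          (p := 2) (by norm_num)
        norm_num at this
        rwa [mul_add] at this
    _ = 2 * (∫⁻ y : ℝ, ‖F ((x : ℂ) + (y : ℂ) * Complex.I)‖ₑ ^ 2) +
          2 * ∫⁻ y : ℝ, ‖G ((x : ℂ) + (y : ℂ) * Complex.I)‖ₑ ^ 2 := by
        rw [lintegral_add_left (hm.const_mul 2), lintegral_const_mul' _ _ (by norm_num),
          lintegral_const_mul' _ _ (by norm_num)]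
    _ ≤ _ := by
        gcongr
        · exact le_iSup₂ (f := fun (x : ℝ) (_ : 0 < x) =>
            ∫⁻ y : ℝ, ‖F ((x : ℂ) + (y : ℂ) * Complex.I)‖ₑ ^ 2) x hx
        · exact le_iSup₂ (f := fun (x : ℝ) (_ : 0 < x) =>
            ∫⁻ y : ℝ, ‖G ((x : ℂ) + (y : ℂ) * Complex.I)‖ₑ ^ 2) x hx

theorem IsHardyFunction.smul {F : ℂ → ℂ} (c : ℂ) (hF : IsHardyFunction F) :
    IsHardyFunction (c • F) := by
  refine ⟨hF.1.const_smul c, ?_⟩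
  refine lt_of_le_of_lt ?_ (ENNReal.mul_lt_top
    (ENNReal.pow_lt_top (enorm_lt_top : ‖c‖ₑ < ∞) : ‖c‖ₑ ^ 2 < ∞) hF.2)
  refine iSup₂_le fun x hx => ?_
  simp only [Pi.smul_apply, smul_eq_mul, enorm_mul, mul_pow]
  rw [lintegral_const_mul' _ _ (ENNReal.pow_lt_top enorm_lt_top).ne]
  gcongr
  exact le_iSup₂ (f := fun (x : ℝ) (_ : 0 < x) =>
    ∫⁻ y : ℝ, ‖F ((x : ℂ) + (y : ℂ) * Complex.I)‖ₑ ^ 2) x hx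

/-- `H²₊(iℝ)`: the `g ∈ L²(iℝ)` that are the boundary functions
`g(s) = lim_{x → 0⁺} F(x + s)`, for almost every `s ∈ iℝ`, of some `F` in the Hardy space of the
right half plane. -/
def hardyPlus : Submodule ℂ L2Imag where
  carrier := {g | ∃ F : ℂ → ℂ, IsHardyFunction F ∧
    ∀ᵐ s ∂imagAxis, Tendsto (fun x : ℝ => F ((x : ℂ) + s)) (𝓝[>] 0) (𝓝 (g s))}
  zero_mem' := by
    refine ⟨0, ⟨differentiableOn_const 0, by simp⟩, ?_⟩
    filter_upwards [Lp.coeFn_zero ℂ 2 imagAxis] with s hs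
    rw [hs]
    exact tendsto_const_nhds
  add_mem' := by
    rintro f g ⟨F, hF, hf⟩ ⟨G, hG, hg⟩
    refine ⟨F + G, hF.add hG, ?_⟩
    filter_upwards [Lp.coeFn_add f g, hf, hg] with s hs h1 h2
    rw [hs]
    exact h1.add h2
  smul_mem' := by
    rintro c f ⟨F, hF, hf⟩
    refine ⟨c • F, hF.smul c, ?_⟩
    filter_upwards [Lp.coeFn_smul c f, hf] with s hs h1
    rw [hs]
    exact h1.const_smul c

end HardyMellin

end

open MeasureTheory Set Filter Topology
open scoped ENNReal

noncomputable section

namespace HardyMellin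

open scoped FourierTransform

/-! ### The Fourier transform on `L¹ ∩ L²` -/

/-! The substitution t = e^{-2πu}, weighted by the square root of its Jacobian, is a unitary map
L²(0, ∞) → L²(ℝ) that turns the Mellin kernel into the Fourier kernel. So `mellinIso` is defined as
this substitution followed by the Plancherel transform and the identification of ℝ with the
imaginary axis. It is given by an absolutely convergent integral whenever f(t) t^{-1/2} is
integrable (`mellinIso_eq_integral`), and truncation to [1/R, R] recovers the L² limit
(`isMellinTransform_mellinIso`).

The intertwining relation for H_∞ need only be checked on the indicators of (0, c], whose span is
dense. There (I - H_∞)1_{(0,c]} = -c t⁻¹ 1_{(c,∞)}, both transforms are explicit, and after s ↦ -s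
their quotient is φ(s) (`mellinReflIso_sub_hardyInf`). On the imaginary axis φ(-s) is the conjugate
of φ(s), so taking adjoints gives the relation for H_∞^*. The relation for H_1^* follows because
averages at x < 1 depend only on values in (0, 1).

For f in L²(0, 1) the transform extends analytically to the right half plane. Plancherel bounds the
extension on vertical lines; it is the Poisson integral of Qf, and Poisson integrals converge almost
everywhere to their boundary data. Conversely, let Qf be the boundary function of F in H². By
Cauchy's theorem F times `tailKernel c` has the same integral over every vertical line; this
integral vanishes as the line moves to the right, hence also on the boundary. For c ≥ 1 this says
that f is orthogonal to t⁻¹ 1_{(c,∞)}, which forces f = 0 on (1, ∞). -/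

theorem fourier_toLp_ae_eq {h : ℝ → ℂ} (h1 : Integrable h) (h2 : MemLp h 2) :
    ((𝓕 (h2.toLp h) : Lp ℂ 2 (volume : Measure ℝ)) : ℝ → ℂ) =ᵐ[volume] 𝓕 h := by
  have hc : Continuous (𝓕 h) :=
    VectorFourier.fourierIntegral_continuous Real.continuous_fourierChar
      (by exact continuous_inner) h1
  -- Both transforms are tested against smooth compactly supported functions: the L² transform
  -- agrees with the distributional one, and the Fourier integral can be moved to the test function
  -- by Fubini.
  refine ae_eq_of_integral_contDiff_smul_eq
    ((Lp.memLp _).locallyIntegrable (by norm_num)) hc.locallyIntegrable fun g hg hgs => ?_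
  have hG : ContDiff ℝ ((⊤ : ℕ∞) : WithTop ℕ∞) (fun x => (g x : ℂ)) :=
    Complex.ofRealCLM.contDiff.comp hg
  have hGs : HasCompactSupport (fun x => (g x : ℂ)) :=
    hgs.comp_left (g := fun x : ℝ => (x : ℂ)) Complex.ofReal_zero
  set G := hGs.toSchwartzMap hG with hGdef
  have hGa : ∀ x, G x = (g x : ℂ) := fun x => rfl
  have key := DFunLike.congr_fun (Lp.fourier_toTemperedDistribution_eq (h2.toLp h)) G
  rw [TemperedDistribution.fourier_apply, Lp.toTemperedDistribution_apply,
    Lp.toTemperedDistribution_apply] at key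
  have e1 : ∫ x, g x • (𝓕 (h2.toLp h) : Lp ℂ 2 (volume : Measure ℝ)) x =
      ∫ x, G x • (𝓕 (h2.toLp h) : Lp ℂ 2 (volume : Measure ℝ)) x := by
    simp [hGa]
  have flip := VectorFourier.integral_fourierIntegral_smul_eq_flip (e := Real.fourierChar)
    (μ := (volume : Measure ℝ)) (ν := (volume : Measure ℝ)) (L := innerₗ ℝ)
    (f := fun x => G x) (g := h) Real.continuous_fourierChar (by exact continuous_inner)
    (G.integrable) h1
  rw [e1, ← key]
  have e2 : ∫ x, (𝓕 G) x • (h2.toLp h) x = ∫ x, (𝓕 G) x • h x :=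
    integral_congr_ae (by filter_upwards [h2.coeFn_toLp] with x hx; rw [hx])
  rw [e2]
  have e3 : ∀ x, (𝓕 G) x = 𝓕 (fun x => G x) x := fun x => by
    rw [SchwartzMap.fourier_coe]
  simp only [flip_innerₗ] at flip
  have e4 : ∫ x, g x • 𝓕 h x = ∫ x, G x • 𝓕 h x := by simp [hGa]
  rw [e4]
  simp_rw [e3]
  exact flip

/-! ### The exponential change of variables -/

/-- The substitution `t = e^{-2πu}`. -/
def expSub (u : ℝ) : ℝ := Real.exp (-2 * Real.pi * u)

theorem expSub_pos (u : ℝ) : 0 < expSub u := Real.exp_pos _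

theorem measurable_expSub : Measurable expSub := by unfold expSub; fun_prop

theorem expSub_injective : Function.Injective expSub := fun u v h => by
  have := Real.exp_injective h
  have hp := Real.pi_pos
  nlinarith

theorem expSub_image : expSub '' univ = Ioi 0 := by
  ext t
  simp only [image_univ, mem_range, mem_Ioi]
  refine ⟨fun ⟨u, hu⟩ => hu ▸ expSub_pos u, fun ht => ⟨-Real.log t / (2 * Real.pi), ?_⟩⟩
  have hp := Real.pi_pos
  rw [expSub, ← Real.exp_log ht]
  congr 1
  rw [Real.exp_log ht]
  field_simp

theorem hasDerivAt_expSub (u : ℝ) : HasDerivAt expSub (-(2 * Real.pi * expSub u)) u := by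
  have := ((hasDerivAt_id u).const_mul (-2 * Real.pi)).exp
  refine this.congr_deriv ?_
  simp [expSub]; ring

theorem abs_deriv_expSub (u : ℝ) : |-(2 * Real.pi * expSub u)| = 2 * Real.pi * expSub u := by
  rw [abs_neg, abs_of_pos]
  have := expSub_pos u
  positivity

theorem lintegral_expSub (k : ℝ → ℝ≥0∞) :
    ∫⁻ t in Ioi 0, k t = ∫⁻ u, ENNReal.ofReal (2 * Real.pi * expSub u) * k (expSub u) := by
  rw [← expSub_image, lintegral_image_eq_lintegral_abs_deriv_mul MeasurableSet.univ
    (fun u _ => (hasDerivAt_expSub u).hasDerivWithinAt) expSub_injective.injOn]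
  simp only [abs_deriv_expSub, Measure.restrict_univ]

theorem integral_expSub (k : ℝ → ℂ) :
    ∫ t in Ioi 0, k t = ∫ u, (2 * Real.pi * expSub u) • k (expSub u) := by
  rw [← expSub_image, integral_image_eq_integral_abs_deriv_smul MeasurableSet.univ
    (fun u _ => (hasDerivAt_expSub u).hasDerivWithinAt) expSub_injective.injOn]
  simp only [abs_deriv_expSub, Measure.restrict_univ]

theorem integrableOn_expSub (k : ℝ → ℂ) :
    IntegrableOn k (Ioi 0) ↔ Integrable fun u => (2 * Real.pi * expSub u) • k (expSub u) := by
  rw [← expSub_image, integrableOn_image_iff_integrableOn_abs_deriv_smul MeasurableSet.univ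
    (fun u _ => (hasDerivAt_expSub u).hasDerivWithinAt) expSub_injective.injOn]
  simp only [abs_deriv_expSub, integrableOn_univ]

/-- The Jacobian is strictly positive, so null sets pull back to null sets; almost everywhere
identities on (0, ∞) can therefore be transported to ℝ. -/
theorem quasiMeasurePreserving_expSub :
    Measure.QuasiMeasurePreserving expSub volume (volume.restrict (Ioi (0 : ℝ))) := by
  refine ⟨measurable_expSub, Measure.AbsolutelyContinuous.mk fun N hN h0 => ?_⟩
  rw [Measure.map_apply measurable_expSub hN]
  have h := lintegral_expSub (N.indicator 1)
  rw [lintegral_indicator_one hN, h0, eq_comm, lintegral_eq_zero_iff] at h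
  · rw [measure_eq_zero_iff_ae_notMem]
    filter_upwards [h] with u hu hmem
    have hp := Real.pi_pos
    have := expSub_pos u
    simp [indicator_of_mem (show expSub u ∈ N from hmem)] at hu
    have : 0 < 2 * Real.pi * expSub u := by positivity
    linarith
  · have := measurable_expSub
    exact (by fun_prop : Measurable fun u => ENNReal.ofReal (2 * Real.pi * expSub u)).mul
      ((measurable_one.indicator hN).comp this)

/-- The weighted substitution `f ↦ √(2π) e^{-πu} f(e^{-2πu})`. -/
def logPull (f : ℝ → ℂ) (u : ℝ) : ℂ := (√(2 * Real.pi * expSub u) : ℝ) * f (expSub u)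

/-- The weight squared is exactly the Jacobian 2πt at t = e^{-2πu}. -/
theorem lintegral_logPull (f : ℝ → ℂ) :
    ∫⁻ u, ‖logPull f u‖ₑ ^ 2 = ∫⁻ t in Ioi 0, ‖f t‖ₑ ^ 2 := by
  rw [lintegral_expSub]
  refine lintegral_congr fun u => ?_
  have hp := Real.pi_pos
  have := expSub_pos u
  rw [logPull, enorm_mul, mul_pow]
  congr 1
  rw [← ofReal_norm, Complex.norm_real, Real.norm_of_nonneg (Real.sqrt_nonneg _),
    ← ENNReal.ofReal_pow (Real.sqrt_nonneg _), Real.sq_sqrt (by positivity)]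

theorem eLpNorm_two_eq {α : Type*} [MeasurableSpace α] (μ : Measure α) (f : α → ℂ) :
    eLpNorm f 2 μ = (∫⁻ a, ‖f a‖ₑ ^ 2 ∂μ) ^ (1 / 2 : ℝ) := by
  rw [eLpNorm_eq_lintegral_rpow_enorm_toReal (by norm_num) (by norm_num)]
  simp

theorem eLpNorm_logPull (f : ℝ → ℂ) :
    eLpNorm (logPull f) 2 volume = eLpNorm f 2 (volume.restrict (Ioi 0)) := by
  rw [eLpNorm_two_eq, eLpNorm_two_eq, lintegral_logPull]

theorem logPull_congr {f g : ℝ → ℂ} (h : f =ᵐ[volume.restrict (Ioi 0)] g) :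
    logPull f =ᵐ[volume] logPull g := by
  filter_upwards [quasiMeasurePreserving_expSub.ae h] with u hu
  rw [logPull, logPull, hu]

theorem memLp_logPull {f : ℝ → ℂ} (hf : MemLp f 2 (volume.restrict (Ioi 0))) :
    MemLp (logPull f) 2 volume := by
  refine ⟨?_, (eLpNorm_logPull f).trans_lt hf.2⟩
  have h1 : AEStronglyMeasurable (fun u => f (expSub u)) volume :=
    hf.1.comp_quasiMeasurePreserving quasiMeasurePreserving_expSub
  have h2 : Measurable fun u => ((√(2 * Real.pi * expSub u) : ℝ) : ℂ) := by
    have := measurable_expSub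
    fun_prop
  exact h2.aestronglyMeasurable.mul h1

/-- The isometry `L²(0, ∞) → L²(ℝ)` given by the weighted substitution. -/
def logIso : L2Inf →ₗᵢ[ℂ] Lp ℂ 2 (volume : Measure ℝ) where
  toFun f := (memLp_logPull (Lp.memLp f)).toLp _
  map_add' f g := by
    rw [← MemLp.toLp_add]
    refine MemLp.toLp_congr _ _ ((logPull_congr (Lp.coeFn_add f g)).trans ?_)
    exact Eventually.of_forall fun u => by simp [logPull, mul_add]
  map_smul' c f := by
    rw [RingHom.id_apply, ← MemLp.toLp_const_smul]
    refine MemLp.toLp_congr _ _ ((logPull_congr (Lp.coeFn_smul c f)).trans ?_)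
    exact Eventually.of_forall fun u => by simp [logPull, mul_left_comm]
  norm_map' f := by
    simp only [LinearMap.coe_mk, AddHom.coe_mk]
    rw [Lp.norm_toLp, eLpNorm_logPull, Lp.norm_def]

theorem logIso_surjective : Function.Surjective logIso := by
  intro g
  have hp := Real.pi_pos
  set k : ℝ → ℂ := fun t => ((√(2 * Real.pi * t) : ℝ) : ℂ)⁻¹ * g (-Real.log t / (2 * Real.pi))
    with hk
  have hpull : logPull k = g := by
    funext u
    have := expSub_pos u
    have h0 : √(2 * Real.pi * expSub u) ≠ 0 := by positivity
    rw [logPull, hk]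
    simp only
    rw [mul_inv_cancel_left₀ (by exact_mod_cast h0)]
    congr 1
    rw [expSub, Real.log_exp]
    field_simp
  have hkm : AEStronglyMeasurable k (volume.restrict (Ioi 0)) := by
    refine AEStronglyMeasurable.mul (Measurable.aestronglyMeasurable (by fun_prop)) ?_
    exact ((Lp.stronglyMeasurable g).comp_measurable (by fun_prop)).aestronglyMeasurable
  have hk2 : MemLp k 2 (volume.restrict (Ioi 0)) :=
    ⟨hkm, by rw [← eLpNorm_logPull, hpull]; exact (Lp.memLp g).2⟩
  refine ⟨hk2.toLp k, ?_⟩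
  refine Lp.ext ?_
  refine (memLp_logPull (Lp.memLp _)).coeFn_toLp.trans ((logPull_congr hk2.coeFn_toLp).trans ?_)
  rw [hpull]

/-! ### The imaginary axis as a copy of the line -/

theorem measurable_toImag : Measurable fun β : ℝ => (β : ℂ) * Complex.I := by fun_prop

theorem measurePreserving_toImag :
    MeasurePreserving (fun β : ℝ => (β : ℂ) * Complex.I) volume imagAxis :=
  ⟨measurable_toImag, rfl⟩

/-- An embedding transfers integrals and almost everywhere statements without measurability
assumptions on the integrand or the predicate. -/
theorem measurableEmbedding_toImag : MeasurableEmbedding fun β : ℝ => (β : ℂ) * Complex.I := by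
  refine MeasurableEmbedding.of_measurable_inverse (g := Complex.im) measurable_toImag ?_
    Complex.measurable_im fun β => by simp
  have : range (fun β : ℝ => (β : ℂ) * Complex.I) = Complex.re ⁻¹' {0} := by
    ext z
    simp only [mem_range, mem_preimage, mem_singleton_iff]
    refine ⟨by rintro ⟨β, rfl⟩; simp, fun h => ⟨z.im, ?_⟩⟩
    apply Complex.ext <;> simp [h]
  rw [this]
  exact Complex.measurable_re (measurableSet_singleton 0)

theorem ae_imagAxis_iff {p : ℂ → Prop} :
    (∀ᵐ s ∂imagAxis, p s) ↔ ∀ᵐ β : ℝ, p ((β : ℂ) * Complex.I) :=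
  measurableEmbedding_toImag.ae_map_iff

theorem ae_re_eq_zero : ∀ᵐ s ∂imagAxis, s.re = 0 :=
  ae_imagAxis_iff.2 (Eventually.of_forall fun β => by simp)

theorem lintegral_imagAxis (f : ℂ → ℝ≥0∞) :
    ∫⁻ s, f s ∂imagAxis = ∫⁻ β : ℝ, f ((β : ℂ) * Complex.I) :=
  measurableEmbedding_toImag.lintegral_map f

theorem integral_imagAxis (f : ℂ → ℂ) :
    ∫ s, f s ∂imagAxis = ∫ β : ℝ, f ((β : ℂ) * Complex.I) :=
  measurableEmbedding_toImag.integral_map f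

/-- Restriction to the imaginary axis identifies `L²(iℝ)` with `L²(ℝ)`. -/
def imagIso : L2Imag ≃ₗᵢ[ℂ] Lp ℂ 2 (volume : Measure ℝ) :=
  LinearIsometryEquiv.ofSurjective (Lp.compMeasurePreservingₗᵢ ℂ _ measurePreserving_toImag) <| by
    intro g
    have hm : MemLp (fun s : ℂ => g s.im) 2 imagAxis := by
      refine ⟨((Lp.stronglyMeasurable g).comp_measurable
        Complex.measurable_im).aestronglyMeasurable, ?_⟩
      have : eLpNorm (fun s : ℂ => g s.im) 2 imagAxis = eLpNorm g 2 volume := by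
        rw [eLpNorm_two_eq, eLpNorm_two_eq, lintegral_imagAxis]
        simp
      rw [this]
      exact (Lp.memLp g).2
    refine ⟨hm.toLp _, Lp.ext ?_⟩
    refine (Lp.coeFn_compMeasurePreserving _ measurePreserving_toImag).trans ?_
    filter_upwards [ae_imagAxis_iff.1 hm.coeFn_toLp] with β hβ
    simp [hβ]

theorem imagIso_ae (g : L2Imag) : ∀ᵐ β : ℝ, imagIso g β = g ((β : ℂ) * Complex.I) :=
  Lp.coeFn_compMeasurePreserving g measurePreserving_toImag

/-! ### The modified Mellin transform -/

/-- The modified Mellin transform as a unitary operator. -/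
def mellinIso : L2Inf ≃ₗᵢ[ℂ] L2Imag :=
  ((LinearIsometryEquiv.ofSurjective logIso logIso_surjective).trans
    (Lp.fourierTransformₗᵢ ℝ ℂ)).trans imagIso.symm

theorem mellinIso_ae (f : L2Inf) :
    ∀ᵐ β : ℝ, mellinIso f ((β : ℂ) * Complex.I) =
      (𝓕 (logIso f) : Lp ℂ 2 (volume : Measure ℝ)) β := by
  filter_upwards [imagIso_ae (mellinIso f)] with β hβ
  rw [← hβ]
  have : imagIso (mellinIso f) = 𝓕 (logIso f) := by
    simp only [mellinIso, LinearIsometryEquiv.trans_apply, LinearIsometryEquiv.apply_symm_apply]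
    rfl
  rw [this]

/-- Jacobian times Mellin kernel splits into the Fourier kernel and the weight of `logPull`; the
surplus √(2π) is what the normalisation of the transform cancels. -/
theorem cpow_expSub (u β : ℝ) :
    ((2 * Real.pi * expSub u : ℝ) : ℂ) * (expSub u : ℂ) ^ ((β : ℂ) * Complex.I - 1 / 2) =
      ((√(2 * Real.pi) : ℝ) : ℂ) * (Complex.exp ((-2 * Real.pi * (β * u) : ℝ) * Complex.I) *
        ((√(2 * Real.pi * expSub u) : ℝ) : ℂ)) := by
  have hp := Real.pi_pos
  have hs : √(2 * Real.pi * expSub u) = √(2 * Real.pi) * Real.exp (-Real.pi * u) := by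
    rw [Real.sqrt_mul (by positivity)]
    congr 1
    rw [expSub, Real.sqrt_eq_rpow, ← Real.exp_mul]
    congr 1
    ring
  have hq : ((√(2 * Real.pi) : ℝ) : ℂ) * ((√(2 * Real.pi) : ℝ) : ℂ) = ((2 * Real.pi : ℝ) : ℂ) := by
    rw [← Complex.ofReal_mul, Real.mul_self_sqrt (by positivity)]
  rw [hs, Complex.cpow_def_of_ne_zero (by exact_mod_cast (expSub_pos u).ne'),
    ← Complex.ofReal_log (expSub_pos u).le]
  rw [Complex.ofReal_mul (2 * Real.pi), ← hq, expSub, Real.log_exp]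
  push_cast
  rw [mul_assoc, ← Complex.exp_add,
    show ∀ a b c : ℂ, a * (b * (a * c)) = a * a * (b * c) by intros; ring, ← Complex.exp_add]
  congr 2
  ring

/-- Since |t^{s-1/2}| = t^{-1/2} on the axis, `hk` is absolute convergence of the Mellin integral.
It puts `logPull k` in L¹ ∩ L², where the Plancherel transform is the Fourier integral. -/
theorem mellinIso_eq_integral {f : L2Inf} {k : ℝ → ℂ} (hfk : f =ᵐ[volume.restrict (Ioi 0)] k)
    (hk : IntegrableOn (fun t : ℝ => k t * ((t ^ (-1 / 2 : ℝ) : ℝ) : ℂ)) (Ioi 0)) :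
    ∀ᵐ s ∂imagAxis, mellinIso f s =
      ((√(2 * Real.pi) : ℝ) : ℂ)⁻¹ * ∫ t in Ioi (0 : ℝ), k t * (t : ℂ) ^ (s - 1 / 2) := by
  have hp := Real.pi_pos
  have hq : ((√(2 * Real.pi) : ℝ) : ℂ) ≠ 0 := by
    have : √(2 * Real.pi) ≠ 0 := by positivity
    exact_mod_cast this
  have h2 : MemLp (logPull k) 2 volume :=
    memLp_logPull ((memLp_congr_ae hfk).1 (Lp.memLp f))
  have hiso : logIso f = h2.toLp _ := 
    MemLp.toLp_congr (memLp_logPull (Lp.memLp f)) _ (logPull_congr hfk)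
  have hkey : ∀ u β : ℝ, (2 * Real.pi * expSub u) • (k (expSub u) *
      (expSub u : ℂ) ^ ((β : ℂ) * Complex.I - 1 / 2)) =
      ((√(2 * Real.pi) : ℝ) : ℂ) *
        (Complex.exp ((-2 * Real.pi * (β * u) : ℝ) * Complex.I) * logPull k u) := by
    intro u β
    rw [logPull, Complex.real_smul, mul_left_comm, cpow_expSub]
    ring
  have h1 : Integrable (logPull k) volume := by
    rw [integrableOn_expSub] at hk
    have := hk.const_mul ((√(2 * Real.pi) : ℝ) : ℂ)⁻¹
    refine this.congr (Eventually.of_forall fun u => ?_)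
    -- At β = 0 the Fourier kernel is 1, so the kernel identity compares the hypothesis with
    -- `logPull k` itself.
    have h0 := hkey u 0
    simp only [Complex.ofReal_zero, zero_mul, zero_sub, mul_zero, Complex.exp_zero,
      one_mul] at h0
    simp only
    rw [Complex.ofReal_cpow (expSub_pos u).le]
    push_cast
    rw [neg_div, h0, inv_mul_cancel_left₀ hq]
  rw [ae_imagAxis_iff]
  filter_upwards [mellinIso_ae f, hiso ▸ fourier_toLp_ae_eq h1 h2] with β h3 h4
  rw [h3, h4, integral_expSub, Real.fourier_eq']
  simp_rw [hkey, integral_const_mul, inv_mul_cancel_left₀ hq, smul_eq_mul]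
  simp

/-! ### The transform as a limit of truncated integrals -/

theorem tendsto_eLpNorm_sub_truncation {f : ℝ → ℂ} (hf : MemLp f 2 (volume.restrict (Ioi 0))) :
    Tendsto (fun R : ℝ => eLpNorm (fun t => f t - (Ioc R⁻¹ R).indicator f t) 2
      (volume.restrict (Ioi 0))) atTop (𝓝 0) := by
  simp only [eLpNorm_two_eq]
  have hfin : ∫⁻ t in Ioi 0, ‖f t‖ₑ ^ 2 ≠ ∞ := by
    have := hf.2
    rw [eLpNorm_two_eq, ENNReal.rpow_lt_top_iff_of_pos (by norm_num)] at this
    exact this.ne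
  have key : Tendsto (fun R : ℝ => ∫⁻ t in Ioi 0, ‖f t - (Ioc R⁻¹ R).indicator f t‖ₑ ^ 2)
      atTop (𝓝 (∫⁻ _ in Ioi (0 : ℝ), 0)) := by
    refine tendsto_lintegral_filter_of_dominated_convergence' (fun t => ‖f t‖ₑ ^ 2)
      (Eventually.of_forall fun R => ?_) (Eventually.of_forall fun R => ?_) hfin ?_
    · exact ((hf.1.sub (hf.1.indicator measurableSet_Ioc)).enorm).pow_const 2
    · refine Eventually.of_forall fun t => ?_
      by_cases h : t ∈ Ioc R⁻¹ R <;> simp [h]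
    · filter_upwards [ae_restrict_mem measurableSet_Ioi] with t ht
      have ht : 0 < t := ht
      refine tendsto_const_nhds.congr' ?_
      filter_upwards [eventually_ge_atTop t, eventually_gt_atTop t⁻¹] with R h1 h2
      have h3 : t ∈ Ioc R⁻¹ R := ⟨inv_lt_of_inv_lt₀ ht h2, h1⟩
      simp [h3]
  have := key.ennrpow_const (1 / 2 : ℝ)
  simpa using this

theorem memLp_truncation {f : ℝ → ℂ} (hf : MemLp f 2 (volume.restrict (Ioi 0))) (R : ℝ) :
    MemLp ((Ioc R⁻¹ R).indicator f) 2 (volume.restrict (Ioi 0)) :=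
  hf.indicator measurableSet_Ioc

theorem integrableOn_truncation {f : ℝ → ℂ} (hf : MemLp f 2 (volume.restrict (Ioi 0))) {R : ℝ}
    (hR : 0 < R) :
    IntegrableOn (fun t : ℝ => (Ioc R⁻¹ R).indicator f t * ((t ^ (-1 / 2 : ℝ) : ℝ) : ℂ))
      (Ioi 0) := by
  have hsub : Icc R⁻¹ R ⊆ Ioi 0 := fun t ht => (inv_pos.2 hR).trans_le ht.1
  have h1 : IntegrableOn f (Icc R⁻¹ R) :=
    (hf.mono_measure (Measure.restrict_mono_set _ hsub)).integrable (by norm_num)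
  have h2 : ContinuousOn (fun t : ℝ => ((t ^ (-1 / 2 : ℝ) : ℝ) : ℂ)) (Icc R⁻¹ R) :=
    Complex.continuous_ofReal.comp_continuousOn
      (continuousOn_id.rpow_const fun t ht => Or.inl (hsub ht).ne')
  have h3 := (h1.mul_continuousOn h2 isCompact_Icc).mono_set Ioc_subset_Icc_self
  have h4 := (integrable_indicator_iff measurableSet_Ioc).2 h3
  refine (h4.congr (Eventually.of_forall fun t => ?_)).integrableOn
  by_cases h : t ∈ Ioc R⁻¹ R <;> simp [h]

/-- The truncated integral is the transform of the truncated function, so by isometry the error is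
the L² norm of f minus its truncation. -/
theorem isMellinTransform_mellinIso (f : L2Inf) : IsMellinTransform f (mellinIso f) := by
  refine (tendsto_eLpNorm_sub_truncation (Lp.memLp f)).congr' ?_
  filter_upwards [eventually_ge_atTop (1 : ℝ)] with R hR
  have hR0 : 0 < R := one_pos.trans_le hR
  have hle : R⁻¹ ≤ R := (inv_le_one_of_one_le₀ hR).trans hR
  have hm := memLp_truncation (Lp.memLp f) R
  have h1 := mellinIso_eq_integral hm.coeFn_toLp (integrableOn_truncation (Lp.memLp f) hR0)
  have e1 : eLpNorm (fun t => f t - (Ioc R⁻¹ R).indicator f t) 2 (volume.restrict (Ioi 0)) =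
      ‖f - hm.toLp _‖ₑ := by
    rw [Lp.enorm_def]
    refine eLpNorm_congr_ae ?_
    filter_upwards [Lp.coeFn_sub f (hm.toLp _), hm.coeFn_toLp] with t h2 h3
    rw [h2, Pi.sub_apply, h3]
  rw [e1, ← mellinIso.enorm_map, map_sub, Lp.enorm_def]
  refine eLpNorm_congr_ae ?_
  filter_upwards [h1, Lp.coeFn_sub (mellinIso f) (mellinIso (hm.toLp _))] with s h2 h3
  rw [h3, Pi.sub_apply, h2, intervalIntegral.integral_of_le hle]
  congr 2
  have : ∀ t : ℝ, (Ioc R⁻¹ R).indicator f t * (t : ℂ) ^ (s - 1 / 2) =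
      (Ioc R⁻¹ R).indicator (fun t => f t * (t : ℂ) ^ (s - 1 / 2)) t := fun t => by
    by_cases h : t ∈ Ioc R⁻¹ R <;> simp [h]
  simp_rw [this]
  rw [setIntegral_indicator measurableSet_Ioc, inter_eq_right.2]
  exact fun t ht => (inv_pos.2 hR0).trans ht.1

/-! ### Functions determined by their primitives -/

/-- At almost every x the primitive has derivative f(x) by Lebesgue differentiation, while to the
right of a it is locally the constant 0. -/
theorem ae_eq_zero_of_primitive_eq_zero {f : ℝ → ℂ} (hf : LocallyIntegrable f) {a : ℝ}
    (h : ∀ x, a < x → ∫ t in a..x, f t = 0) : ∀ᵐ x, a < x → f x = 0 := by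
  filter_upwards [LocallyIntegrable.ae_hasDerivAt_integral hf] with x hx hax
  refine (hx a).unique ((hasDerivAt_const x (0 : ℂ)).congr_of_eventuallyEq ?_)
  filter_upwards [lt_mem_nhds hax] with y hy
  exact h y hy

theorem locallyIntegrable_indicator (f : L2Inf) {s : Set ℝ} (hs : MeasurableSet s)
    (hs0 : s ⊆ Ioi 0) : LocallyIntegrable (s.indicator f) := by
  have h : MemLp (s.indicator f) 2 volume := by
    rw [memLp_indicator_iff_restrict hs]
    exact (Lp.memLp f).mono_measure (Measure.restrict_mono_set _ hs0)
  exact h.locallyIntegrable (by norm_num)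

/-! ### Two families of test functions -/

theorem memLp_indLow (c : ℝ) :
    MemLp ((Ioc 0 c).indicator fun _ : ℝ => (1 : ℂ)) 2 (volume.restrict (Ioi 0)) := by
  refine memLp_indicator_const 2 measurableSet_Ioc 1 (Or.inr ?_)
  exact ((Measure.restrict_apply_le _ _).trans_lt (by simp)).ne

/-- The indicator function of `(0, c]`. -/
def indLow (c : ℝ) : L2Inf := (memLp_indLow c).toLp _

theorem memLp_invTail {c : ℝ} (hc : 0 < c) :
    MemLp ((Ioi c).indicator fun t : ℝ => (t : ℂ)⁻¹) 2 (volume.restrict (Ioi 0)) := by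
  have hm : AEStronglyMeasurable (fun t : ℝ => (t : ℂ)⁻¹) (volume.restrict (Ioi c)) :=
    Measurable.aestronglyMeasurable (by fun_prop)
  rw [memLp_indicator_iff_restrict measurableSet_Ioi,
    Measure.restrict_restrict measurableSet_Ioi, inter_eq_left.2 (Ioi_subset_Ioi hc.le),
    memLp_two_iff_integrable_sq_norm hm]
  refine (integrableOn_Ioi_rpow_of_lt (a := -2) (by norm_num) hc).congr_fun (fun t ht => ?_)
    measurableSet_Ioi
  have ht0 : 0 < t := hc.trans ht
  simp only [norm_inv, Complex.norm_real, Real.norm_of_nonneg ht0.le]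
  rw [Real.rpow_neg ht0.le, inv_pow]
  norm_num

/-- The function `t⁻¹` on `(c, ∞)`, extended by zero. -/
def invTail (c : ℝ) (hc : 0 < c) : L2Inf := (memLp_invTail hc).toLp _

theorem inner_indLow (c : ℝ) (f : L2Inf) : inner ℂ (indLow c) f = ∫ t in Ioc 0 c, f t := by
  rw [L2.inner_def]
  have : ∫ t in Ioi 0, inner ℂ (indLow c t) (f t) = ∫ t in Ioi 0, (Ioc 0 c).indicator f t := by
    refine integral_congr_ae ?_
    filter_upwards [(memLp_indLow c).coeFn_toLp] with t ht
    rw [indLow, ht]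
    by_cases h : t ∈ Ioc 0 c <;> simp [h]
  rw [this, setIntegral_indicator measurableSet_Ioc, inter_eq_right.2 fun t ht => ht.1]

theorem inner_invTail {c : ℝ} (hc : 0 < c) (f : L2Inf) :
    inner ℂ (invTail c hc) f = ∫ t in Ioi c, (t : ℂ)⁻¹ * f t := by
  rw [L2.inner_def]
  have : ∫ t in Ioi 0, inner ℂ (invTail c hc t) (f t) =
      ∫ t in Ioi 0, (Ioi c).indicator (fun t : ℝ => (t : ℂ)⁻¹ * f t) t := by
    refine integral_congr_ae ?_
    filter_upwards [(memLp_invTail hc).coeFn_toLp] with t ht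
    rw [invTail, ht]
    by_cases h : t ∈ Ioi c
    · simp [indicator_of_mem h, mul_comm]
    · simp [indicator_of_notMem h]
  rw [this, setIntegral_indicator measurableSet_Ioi,
    inter_eq_right.2 (Ioi_subset_Ioi hc.le)]

theorem integrableOn_invTail {c : ℝ} (hc : 0 < c) (f : L2Inf) :
    IntegrableOn (fun t : ℝ => (t : ℂ)⁻¹ * f t) (Ioi c) := by
  have h := (memLp_invTail hc).integrable_mul (Lp.memLp f)
  have h' := IntegrableOn.mono_set (t := Ioi 0) (μ := volume) h (Ioi_subset_Ioi hc.le)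
  refine h'.congr_fun (fun t ht => ?_) measurableSet_Ioi
  simp [indicator_of_mem ht]

/-- Orthogonality to all these indicators says that every primitive from 0 vanishes. -/
theorem span_indLow_dense :
    Dense (Submodule.span ℂ {f : L2Inf | ∃ c : ℝ, 0 < c ∧ f = indLow c} : Set L2Inf) := by
  rw [Submodule.dense_iff_topologicalClosure_eq_top,
    Submodule.topologicalClosure_eq_top_iff, Submodule.eq_bot_iff]
  intro f hf
  rw [Submodule.mem_orthogonal] at hf
  have hz : ∀ x, 0 < x → ∫ t in (0 : ℝ)..x, (Ioi 0).indicator f t = 0 := fun x hx => by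
    have h1 := hf (indLow x) (Submodule.subset_span ⟨x, hx, rfl⟩)
    rw [inner_indLow] at h1
    rw [intervalIntegral.integral_of_le hx.le, ← h1]
    exact setIntegral_congr_fun measurableSet_Ioc fun t ht => by
      simp [indicator_of_mem (show t ∈ Ioi 0 from ht.1)]
  rw [Lp.eq_zero_iff_ae_eq_zero]
  have := ae_eq_zero_of_primitive_eq_zero
    (locallyIntegrable_indicator f measurableSet_Ioi subset_rfl) hz
  rw [EventuallyEq, ae_restrict_iff' measurableSet_Ioi]
  filter_upwards [this] with t ht ht0
  simpa [indicator_of_mem ht0] using ht ht0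

/-- The pairing is the integral of f(t)/t over (c, ∞); subtracting the cases c = x and c = 1 kills
the primitive of f(t)/t from 1. This detects membership in L²(0, 1). -/
theorem ae_eq_zero_of_inner_invTail {f : L2Inf}
    (h : ∀ c (hc : 1 ≤ c), inner ℂ (invTail c (one_pos.trans_le hc)) f = 0) :
    ∀ᵐ t : ℝ, 1 < t → f t = 0 := by
  have hi := integrableOn_invTail one_pos f
  have hz : ∀ x, 1 < x →
      ∫ t in (1 : ℝ)..x, (Ioi 1).indicator (fun t : ℝ => (t : ℂ)⁻¹ * f t) t = 0 := fun x hx => by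
    have h1 := h 1 le_rfl
    have h2 := h x hx.le
    rw [inner_invTail] at h1 h2
    have h3 := intervalIntegral.integral_Ioi_sub_Ioi hi hx.le
    rw [h1, h2, sub_zero] at h3
    rw [intervalIntegral.integral_of_le hx.le] at h3 ⊢
    rw [h3]
    exact setIntegral_congr_fun measurableSet_Ioc fun t ht => by
      simp [indicator_of_mem (show t ∈ Ioi 1 from ht.1)]
  have := ae_eq_zero_of_primitive_eq_zero
    ((integrable_indicator_iff measurableSet_Ioi).2 hi).locallyIntegrable hz
  filter_upwards [this] with t ht ht1
  have h0 := ht ht1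
  rw [indicator_of_mem (show t ∈ Ioi 1 from ht1)] at h0
  have : (t : ℂ) ≠ 0 := by exact_mod_cast (one_pos.trans ht1).ne'
  simpa [this] using h0

/-- The average of the indicator is 1 for x ≤ c, where it cancels, and c/x for x > c. -/
theorem indLow_sub_hardyInf {c : ℝ} (hc : 0 < c) :
    indLow c - hardyInf (indLow c) = (-c : ℂ) • invTail c hc := by
  refine Lp.ext ?_
  have h1 : hardyInf (indLow c) =ᵐ[volume.restrict (Ioi 0)] average (indLow c) :=
    (memLp_average isInitial_Ioi (indLow c)).coeFn_toLp
  filter_upwards [Lp.coeFn_sub (indLow c) (hardyInf (indLow c)), (memLp_indLow c).coeFn_toLp,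
    h1, Lp.coeFn_smul (-c : ℂ) (invTail c hc), (memLp_invTail hc).coeFn_toLp,
    ae_restrict_mem measurableSet_Ioi] with x h2 h3 h4 h5 h6 hx
  have hx : 0 < x := hx
  have hx' : (x : ℂ) ≠ 0 := by exact_mod_cast hx.ne'
  rw [h2, h5, Pi.sub_apply, Pi.smul_apply, h4,
    average_congr isInitial_Ioi (f := indLow c) (memLp_indLow c).coeFn_toLp hx, invTail, h6,
    indLow, h3, average, intervalIntegral.integral_of_le hx.le, setIntegral_indicator measurableSet_Ioc,
    Ioc_inter_Ioc]
  rcases le_or_gt x c with h | h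
  · simp [hx, h, hx.le, hx']
  · simp [h, hc.le, h.le, mul_comm]

/-! ### Mellin transforms of the test functions -/

theorem mellinIso_indLow {c : ℝ} (hc : 0 < c) :
    ∀ᵐ s ∂imagAxis, mellinIso (indLow c) s =
      ((√(2 * Real.pi) : ℝ) : ℂ)⁻¹ * ((c : ℂ) ^ (s + 1 / 2) / (s + 1 / 2)) := by
  have hi : IntegrableOn (fun t : ℝ => (Ioc 0 c).indicator (fun _ => (1 : ℂ)) t *
      ((t ^ (-1 / 2 : ℝ) : ℝ) : ℂ)) (Ioi 0) := by
    have h1 : IntegrableOn (fun t : ℝ => t ^ (-1 / 2 : ℝ)) (Ioc 0 c) := by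
      rw [← intervalIntegrable_iff_integrableOn_Ioc_of_le hc.le]
      exact intervalIntegral.intervalIntegrable_rpow' (by norm_num)
    have h1' : IntegrableOn (fun t : ℝ => ((t ^ (-1 / 2 : ℝ) : ℝ) : ℂ)) (Ioc 0 c) :=
      Integrable.ofReal h1
    have h2 := (integrable_indicator_iff measurableSet_Ioc).2 h1'
    refine (h2.congr (Eventually.of_forall fun t => ?_)).integrableOn
    by_cases h : t ∈ Ioc 0 c <;> simp [h]
  filter_upwards [mellinIso_eq_integral (memLp_indLow c).coeFn_toLp hi, ae_re_eq_zero] with s h1 hs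
  rw [indLow, h1]
  congr 1
  have : ∀ t : ℝ, (Ioc 0 c).indicator (fun _ => (1 : ℂ)) t * (t : ℂ) ^ (s - 1 / 2) =
      (Ioc 0 c).indicator (fun t : ℝ => (t : ℂ) ^ (s - 1 / 2)) t := fun t => by
    by_cases h : t ∈ Ioc 0 c <;> simp [h]
  simp_rw [this]
  rw [setIntegral_indicator measurableSet_Ioc, inter_eq_right.2 fun t ht => ht.1,
    ← intervalIntegral.integral_of_le hc.le, integral_cpow (Or.inl (by simp [hs]; norm_num))]
  have h2 : s - 1 / 2 + 1 = s + 1 / 2 := by ring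
  have h3 : s + 1 / 2 ≠ 0 := fun h => by
    have := congrArg Complex.re h
    simp [hs] at this
  rw [h2, Complex.ofReal_zero, Complex.zero_cpow h3, sub_zero]

theorem mellinIso_invTail {c : ℝ} (hc : 0 < c) :
    ∀ᵐ s ∂imagAxis, mellinIso (invTail c hc) s =
      ((√(2 * Real.pi) : ℝ) : ℂ)⁻¹ * ((c : ℂ) ^ (s - 1 / 2) / (1 / 2 - s)) := by
  have hi : IntegrableOn (fun t : ℝ => (Ioi c).indicator (fun t : ℝ => (t : ℂ)⁻¹) t *
      ((t ^ (-1 / 2 : ℝ) : ℝ) : ℂ)) (Ioi 0) := by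
    have h1 := integrableOn_Ioi_rpow_of_lt (a := -3 / 2) (by norm_num) hc
    have h1' : IntegrableOn (fun t : ℝ => ((t ^ (-3 / 2 : ℝ) : ℝ) : ℂ)) (Ioi c) :=
      Integrable.ofReal h1
    have h2 := (integrable_indicator_iff measurableSet_Ioi).2 h1'
    refine (h2.congr (Eventually.of_forall fun t => ?_)).integrableOn
    by_cases h : t ∈ Ioi c
    · have ht : 0 < t := hc.trans h
      simp only [indicator_of_mem h]
      have : t ^ (-3 / 2 : ℝ) = t⁻¹ * t ^ (-1 / 2 : ℝ) := by
        rw [← Real.rpow_neg_one, ← Real.rpow_add ht]; norm_num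
      simp [this]
    · simp [indicator_of_notMem h]
  filter_upwards [mellinIso_eq_integral (memLp_invTail hc).coeFn_toLp hi, ae_re_eq_zero] with s h1 hs
  rw [invTail, h1]
  congr 1
  have : ∀ t ∈ Ioi (0 : ℝ), (Ioi c).indicator (fun t : ℝ => (t : ℂ)⁻¹) t *
      (t : ℂ) ^ (s - 1 / 2) = (Ioi c).indicator (fun t : ℝ => (t : ℂ) ^ (s - 3 / 2)) t := by
    intro t ht
    have ht0 : (t : ℂ) ≠ 0 := by exact_mod_cast (ne_of_gt ht : t ≠ 0)
    by_cases h : t ∈ Ioi c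
    · simp only [indicator_of_mem h]
      rw [← Complex.cpow_neg_one, ← Complex.cpow_add _ _ ht0]
      congr 1; ring
    · simp [indicator_of_notMem h]
  rw [setIntegral_congr_fun measurableSet_Ioi this, setIntegral_indicator measurableSet_Ioi,
    inter_eq_right.2 (Ioi_subset_Ioi hc.le),
    integral_Ioi_cpow_of_lt (by simp [hs]; norm_num) hc]
  have h2 : s - 3 / 2 + 1 = s - 1 / 2 := by ring
  rw [h2, ← neg_sub s, div_neg, neg_div]

/-! ### The intertwining relations -/

theorem mulPhi_ae (g : L2Imag) : ∀ᵐ s ∂imagAxis, mulPhi g s = phi s * g s := by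
  filter_upwards [(ContinuousLinearMap.mul ℂ ℂ).coeFn_holder (r := 2) (memLp_phi.toLp phi) g,
    memLp_phi.coeFn_toLp] with s h1 h2
  rw [← h2]
  exact h1

theorem measurePreserving_neg_imagAxis : MeasurePreserving (fun s : ℂ => -s) imagAxis imagAxis := by
  refine ⟨measurable_neg, ?_⟩
  rw [imagAxis, Measure.map_map measurable_neg measurable_toImag]
  have : (fun s : ℂ => -s) ∘ (fun β : ℝ => (β : ℂ) * Complex.I) =
      (fun β : ℝ => (β : ℂ) * Complex.I) ∘ fun β : ℝ => -β := by
    funext β; simp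
  rw [this, ← Measure.map_map measurable_toImag measurable_neg]
  congr 1
  exact (Measure.measurePreserving_neg volume).map_eq

theorem ae_neg_imagAxis {p : ℂ → Prop} (h : ∀ᵐ s ∂imagAxis, p s) : ∀ᵐ s ∂imagAxis, p (-s) :=
  measurePreserving_neg_imagAxis.quasiMeasurePreserving.ae h

theorem reflection_ae (g : L2Imag) :
    ∀ᵐ s ∂imagAxis,
      Lp.compMeasurePreservingₗᵢ ℂ _ measurePreserving_neg_imagAxis g s = g (-s) :=
  Lp.coeFn_compMeasurePreserving g measurePreserving_neg_imagAxis

/-- The reflection `g(s) ↦ g(-s)` on `L²(iℝ)`. -/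
def reflection : L2Imag ≃ₗᵢ[ℂ] L2Imag :=
  LinearIsometryEquiv.ofSurjective
    (Lp.compMeasurePreservingₗᵢ ℂ _ measurePreserving_neg_imagAxis) fun g => by
      refine ⟨Lp.compMeasurePreservingₗᵢ ℂ _ measurePreserving_neg_imagAxis g, Lp.ext ?_⟩
      filter_upwards [reflection_ae (Lp.compMeasurePreservingₗᵢ ℂ _
        measurePreserving_neg_imagAxis g), ae_neg_imagAxis (reflection_ae g)] with s h1 h2
      rw [h1, h2, neg_neg]

/-- The reflected Mellin transform `f ↦ (s ↦ (Q f)(-s))`. -/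
def mellinReflIso : L2Inf ≃ₗᵢ[ℂ] L2Imag := mellinIso.trans reflection

theorem mellinReflIso_ae (f : L2Inf) : ∀ᵐ s ∂imagAxis, mellinReflIso f s = mellinIso f (-s) :=
  reflection_ae (mellinIso f)

/-- By density f may be taken to be an indicator of (0, c]. At -s the two transforms are, up to the
common factor (2π)^{-1/2}, -c · c^{-s-1/2}/(s + 1/2) and c^{-s+1/2}/(1/2 - s), with quotient (s -
1/2)/(s + 1/2). -/
theorem mellinReflIso_sub_hardyInf (f : L2Inf) :
    mellinReflIso (f - hardyInf f) = mulPhi (mellinReflIso f) := by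
  set T : L2Inf →L[ℂ] L2Imag := (mellinReflIso : L2Inf →L[ℂ] L2Imag)
  have key : T ∘L (ContinuousLinearMap.id ℂ L2Inf - hardyInf) = mulPhi ∘L T := by
    refine ContinuousLinearMap.ext_on span_indLow_dense ?_
    rintro _ ⟨c, hc, rfl⟩
    change mellinReflIso (indLow c - hardyInf (indLow c)) = mulPhi (mellinReflIso (indLow c))
    rw [indLow_sub_hardyInf hc, map_smul]
    refine Lp.ext ?_
    filter_upwards [Lp.coeFn_smul (-c : ℂ) (mellinReflIso (invTail c hc)),
      mellinReflIso_ae (invTail c hc), mellinReflIso_ae (indLow c),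
      mulPhi_ae (mellinReflIso (indLow c)), ae_neg_imagAxis (mellinIso_indLow hc),
      ae_neg_imagAxis (mellinIso_invTail hc), ae_re_eq_zero] with s h1 h2 h3 h4 h5 h6 hs
    rw [h1, Pi.smul_apply, h2, h4, h3, h5, h6, smul_eq_mul, phi]
    have hc0 : (c : ℂ) ≠ 0 := by exact_mod_cast hc.ne'
    have e : (c : ℂ) ^ (-s + 1 / 2) = (c : ℂ) ^ (-s - 1 / 2) * c := by
      nth_rewrite 3 [← Complex.cpow_one (c : ℂ)]
      rw [← Complex.cpow_add _ _ hc0]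
      congr 1; ring
    have n1 : s + 1 / 2 ≠ 0 := fun h => by
      have := congrArg Complex.re h
      simp [hs] at this
    have n2 : -s + 1 / 2 ≠ 0 := fun h => by
      have := congrArg Complex.re h
      simp [hs] at this
    have e1 : 1 / 2 - -s = s + 1 / 2 := by ring
    have e2 : s - 1 / 2 = -(-s + 1 / 2) := by ring
    rw [e, e1, e2]
    generalize s + 1 / 2 = p at n1
    generalize -s + 1 / 2 = q at n2
    field_simp
  exact DFunLike.congr_fun key f

theorem conj_phi {s : ℂ} (hs : s.re = 0) : (starRingEnd ℂ) (phi s) = phi (-s) := by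
  have : (starRingEnd ℂ) s = -s := by apply Complex.ext <;> simp [hs]
  simp only [phi, map_div₀, map_sub, map_add, map_one, map_ofNat, this]

theorem mellinIso_sub_hardyInf (f : L2Inf) :
    ∀ᵐ s ∂imagAxis, mellinIso (f - hardyInf f) s = phi (-s) * mellinIso f s := by
  have h := mellinReflIso_sub_hardyInf f
  have h1 := mellinReflIso_ae (f - hardyInf f)
  rw [h] at h1
  filter_upwards [ae_neg_imagAxis h1, ae_neg_imagAxis (mulPhi_ae (mellinReflIso f)),
    ae_neg_imagAxis (mellinReflIso_ae f)] with s h2 h3 h4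
  rw [neg_neg] at h2 h4
  rw [← h2, h3, h4]

/-- Under the transform I - H_∞ is multiplication by φ(-s), and the adjoint of a multiplication
operator multiplies by the conjugate symbol, which is φ(s) on the axis. -/
theorem mellinIso_sub_adjoint_hardyInf (f : L2Inf) :
    mellinIso (f - ContinuousLinearMap.adjoint hardyInf f) = mulPhi (mellinIso f) := by
  refine ext_inner_right ℂ fun g => ?_
  obtain ⟨h, rfl⟩ := mellinIso.surjective g
  rw [mellinIso.inner_map_map, inner_sub_left, ContinuousLinearMap.adjoint_inner_left,
    ← inner_sub_right, ← mellinIso.inner_map_map, L2.inner_def, L2.inner_def]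
  refine integral_congr_ae ?_
  filter_upwards [mellinIso_sub_hardyInf h, mulPhi_ae (mellinIso f), ae_re_eq_zero] with s h1 h2 hs
  rw [h1, h2, RCLike.inner_apply, RCLike.inner_apply, map_mul, conj_phi hs]
  ring

/-! ### The finite Hardy operator -/

/-- The adjoint of extension by zero is restriction (`hE`). The claim is thus dual to the fact that
restriction to (0, 1) commutes with averaging, since the average at x uses only values on (0, x]. -/
theorem adjoint_hardyInf_extendZero (f : L2One) :
    ContinuousLinearMap.adjoint hardyInf (extendZero f) =
      extendZero (ContinuousLinearMap.adjoint hardyOne f) := by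
  have hsub : Ioo (0 : ℝ) 1 ⊆ Ioi 0 := fun _ h => h.1
  have hle : (volume : Measure ℝ).restrict (Ioo 0 1) ≤ volume.restrict (Ioi 0) :=
    Measure.restrict_mono_set _ hsub
  have hres : ∀ k : L2Inf, MemLp k 2 (volume.restrict (Ioo (0 : ℝ) 1)) := fun k =>
    (Lp.memLp k).mono_measure hle
  have hE : ∀ (f : L2One) (k : L2Inf),
      inner ℂ (extendZero f) k = inner ℂ f ((hres k).toLp k) := by
    intro f k
    rw [L2.inner_def, L2.inner_def]
    have e1 : ∫ t in Ioi 0, inner ℂ (extendZero f t) (k t) =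
        ∫ t in Ioi 0, (Ioo (0 : ℝ) 1).indicator (fun t => inner ℂ (f t) (k t)) t := by
      refine integral_congr_ae ?_
      filter_upwards [(memLp_extend f).coeFn_toLp] with t ht
      change inner ℂ ((memLp_extend f).toLp _ t) (k t) = _
      rw [ht]
      by_cases h : t ∈ Ioo (0 : ℝ) 1
      · simp only [indicator_of_mem h]
      · simp only [indicator_of_notMem h, inner_zero_left]
    rw [e1, setIntegral_indicator measurableSet_Ioo, inter_eq_right.2 hsub]
    refine integral_congr_ae ?_
    filter_upwards [(hres k).coeFn_toLp] with t ht
    rw [ht]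
  refine ext_inner_right ℂ fun k => ?_
  rw [ContinuousLinearMap.adjoint_inner_left, hE, hE, ContinuousLinearMap.adjoint_inner_left]
  congr 1
  refine Lp.ext ?_
  have h1 : hardyInf k =ᵐ[volume.restrict (Ioi 0)] average k :=
    (memLp_average isInitial_Ioi k).coeFn_toLp
  have h2 : hardyOne ((hres k).toLp k) =ᵐ[volume.restrict (Ioo 0 1)]
      average ((hres k).toLp k) :=
    (memLp_average isInitial_Ioo ((hres k).toLp k)).coeFn_toLp
  filter_upwards [(hres (hardyInf k)).coeFn_toLp, ae_mono hle h1, h2,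
    ae_restrict_mem measurableSet_Ioo] with x h3 h4 h5 hx
  rw [h3, h4, h5]
  exact (average_congr isInitial_Ioo (hres k).coeFn_toLp hx).symm

/-! ### Invariance of the Hardy space -/

theorem add_half_ne_zero {z : ℂ} (hz : 0 ≤ z.re) : z + 1 / 2 ≠ 0 := fun h => by
  have := congrArg Complex.re h
  simp at this
  linarith

theorem norm_phi_le_one {z : ℂ} (hz : 0 < z.re) : ‖phi z‖ ≤ 1 := by
  rw [phi, norm_div]
  refine div_le_one_of_le₀ ?_ (norm_nonneg _)
  rw [← sq_le_sq₀ (norm_nonneg _) (norm_nonneg _), ← Complex.normSq_eq_norm_sq,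
    ← Complex.normSq_eq_norm_sq, Complex.normSq_apply, Complex.normSq_apply]
  simp
  nlinarith

/-- φ is analytic and bounded by 1 on the right half plane and continuous up to the axis, so φF is a
Hardy function with boundary values φg. -/
theorem mulPhi_mem_hardyPlus {g : L2Imag} (hg : g ∈ hardyPlus) : mulPhi g ∈ hardyPlus := by
  obtain ⟨F, hF, hlim⟩ := hg
  refine ⟨fun z => phi z * F z, ⟨?_, ?_⟩, ?_⟩
  · refine DifferentiableOn.mul ?_ hF.1
    intro z hz
    have : DifferentiableAt ℂ phi z := by
      unfold phi
      exact DifferentiableAt.div (by fun_prop) (by fun_prop) (add_half_ne_zero (le_of_lt hz))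
    exact this.differentiableWithinAt
  · refine lt_of_le_of_lt (iSup₂_mono fun x hx => lintegral_mono fun y => ?_) hF.2
    gcongr
    rw [enorm_mul]
    have : ‖phi ((x : ℂ) + (y : ℂ) * Complex.I)‖ₑ ≤ 1 := by
      rw [← ofReal_norm]
      exact ENNReal.ofReal_le_one.2 (norm_phi_le_one (by simpa using hx))
    exact mul_le_of_le_one_left' this
  · filter_upwards [hlim, mulPhi_ae g, ae_re_eq_zero] with s h1 h2 hs
    rw [h2]
    refine Tendsto.mul ?_ h1
    have hc : ContinuousAt (fun x : ℝ => phi ((x : ℂ) + s)) 0 := by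
      unfold phi
      refine ContinuousAt.div (by fun_prop) (by fun_prop) ?_
      exact add_half_ne_zero (by simp [hs])
    have := hc.tendsto
    simp only [Complex.ofReal_zero, zero_add] at this
    exact this.mono_left nhdsWithin_le_nhds

/-! ### Weak convergence of bounded, almost everywhere convergent sequences -/

theorem eLpNorm_mul_one_le {α : Type*} [MeasurableSpace α] {μ : Measure α} {f k : α → ℂ}
    (hf : AEStronglyMeasurable f μ) (hk : AEStronglyMeasurable k μ) :
    eLpNorm (fun a => f a * k a) 1 μ ≤ eLpNorm f 2 μ * eLpNorm k 2 μ := by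
  have h : eLpNorm (f • k) 1 μ ≤ eLpNorm f 2 μ * eLpNorm k 2 μ :=
    eLpNorm_smul_le_mul_eLpNorm hk hf
  exact h

/-- By Cauchy–Schwarz the integral of |f n · k| over a set is at most C times the L² norm of k
there, uniformly in n. The products are thus uniformly integrable and tight, and Vitali's theorem
gives L¹ convergence. -/
theorem tendsto_integral_mul_of_ae_tendsto {α : Type*} [MeasurableSpace α] {μ : Measure α}
    {f : ℕ → α → ℂ} {g k : α → ℂ} {C : ℝ≥0∞} (hC : C ≠ ∞)
    (hf : ∀ n, AEStronglyMeasurable (f n) μ) (hfC : ∀ n, eLpNorm (f n) 2 μ ≤ C)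
    (hg : MemLp g 2 μ) (hk : MemLp k 2 μ)
    (hlim : ∀ᵐ a ∂μ, Tendsto (fun n => f n a) atTop (𝓝 (g a))) :
    Tendsto (fun n => ∫ a, f n a * k a ∂μ) atTop (𝓝 (∫ a, g a * k a ∂μ)) := by
  have hind : ∀ n (s : Set α), MeasurableSet s →
      eLpNorm (s.indicator fun a => f n a * k a) 1 μ ≤ C * eLpNorm (s.indicator k) 2 μ := by
    intro n s hs
    have : (s.indicator fun a => f n a * k a) = fun a => f n a * s.indicator k a := by
      funext a
      by_cases h : a ∈ s <;> simp [h]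
    rw [this]
    refine (eLpNorm_mul_one_le (hf n) (hk.1.indicator hs)).trans ?_
    gcongr
    exact hfC n
  lift C to NNReal using hC
  have hfk : ∀ n, Integrable (fun a => f n a * k a) μ := fun n =>
    memLp_one_iff_integrable.1 ⟨(hf n).mul hk.1, (eLpNorm_mul_one_le (hf n) hk.1).trans_lt
      (ENNReal.mul_lt_top ((hfC n).trans_lt ENNReal.coe_lt_top) hk.2)⟩
  have hgk : MemLp (fun a => g a * k a) 1 μ :=
    ⟨hg.1.mul hk.1, (eLpNorm_mul_one_le hg.1 hk.1).trans_lt (ENNReal.mul_lt_top hg.2 hk.2)⟩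
  have hui : UnifIntegrable (fun n a => f n a * k a) 1 μ := by
    intro ε hε
    -- The denominator C + 1 also covers C = 0.
    have hε' : 0 < ε / (C + 1) := by positivity
    obtain ⟨δ, hδ, h⟩ := hk.eLpNorm_indicator_le (by norm_num) (by norm_num) hε'
    refine ⟨δ, hδ, fun n s hs hμ => (hind n s hs).trans ?_⟩
    refine (mul_le_mul_right (h s hs hμ) _).trans ?_
    rw [← ENNReal.ofReal_coe_nnreal, ← ENNReal.ofReal_mul C.coe_nonneg]
    refine ENNReal.ofReal_le_ofReal ?_
    rw [mul_div_assoc', div_le_iff₀ (by positivity)]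
    nlinarith [C.coe_nonneg]
  have hut : UnifTight (fun n a => f n a * k a) 1 μ := by
    intro ε hε
    have hε' : (ε / (C + 1) : NNReal) ≠ 0 := by positivity
    obtain ⟨s, hs, hμ, h⟩ := hk.exists_eLpNorm_indicator_compl_lt (by norm_num)
      (ε := ((ε / (C + 1) : NNReal) : ℝ≥0∞)) (by exact_mod_cast hε')
    refine ⟨s, hμ.ne, fun n => (hind n _ hs.compl).trans ?_⟩
    refine (mul_le_mul_right h.le _).trans ?_
    rw [← ENNReal.coe_mul, ENNReal.coe_le_coe, mul_div_assoc', div_le_iff₀ (by positivity)]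
    rw [mul_comm ε]
    gcongr
    simp
  have := tendsto_Lp_of_tendsto_ae le_rfl (by norm_num)
    (fun n => (hfk n).aestronglyMeasurable) hgk hui hut
    (by filter_upwards [hlim] with a ha using ha.mul_const _)
  exact tendsto_integral_of_L1' _ hgk.1 (Eventually.of_forall hfk) this

/-! ### Shifting vertical lines of integration -/

theorem continuous_vertical {G : ℂ → ℂ} (hG : DifferentiableOn ℂ G {z : ℂ | 0 < z.re}) {x : ℝ}
    (hx : 0 < x) : Continuous fun y : ℝ => G ((x : ℂ) + (y : ℂ) * Complex.I) :=
  hG.continuousOn.comp_continuous (by fun_prop) fun y => by simpa using hx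

/-- A nonzero limit would bound |h| below on a half-line of infinite measure. This replaces
pointwise decay on the horizontal sides of a contour. -/
theorem eq_zero_of_tendsto_of_lintegral_ne_top {h : ℝ → ℂ} {c : ℂ}
    (hlim : Tendsto h atTop (𝓝 c)) (hfin : ∫⁻ T, ‖h T‖ₑ ≠ ∞) : c = 0 := by
  by_contra hc
  have hpos : 0 < ‖c‖ := norm_pos_iff.2 hc
  have hev := hlim.norm.eventually (lt_mem_nhds (half_lt_self hpos))
  obtain ⟨T₀, hT⟩ := eventually_atTop.1 hev
  refine hfin (top_le_iff.1 ?_)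
  calc (∞ : ℝ≥0∞) = ∫⁻ _ in Ici T₀, ENNReal.ofReal (‖c‖ / 2) := by
        rw [setLIntegral_const, Real.volume_Ici, ENNReal.mul_top]
        simpa using hpos
    _ ≤ ∫⁻ T in Ici T₀, ‖h T‖ₑ := by
        refine setLIntegral_mono' measurableSet_Ici fun T hT' => ?_
        rw [← ofReal_norm]
        exact ENNReal.ofReal_le_ofReal (hT T hT').le
    _ ≤ _ := setLIntegral_le_lintegral _ _

/-- Extension by zero gives a function measurable on all of ℂ, as Tonelli's theorem on horizontal
segments requires. -/
theorem measurable_indicator_halfPlane {G : ℂ → ℂ}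
    (hG : DifferentiableOn ℂ G {z : ℂ | 0 < z.re}) :
    Measurable ({z : ℂ | 0 < z.re}.indicator G) := by
  classical
  rw [← piecewise_eq_indicator]
  exact ContinuousOn.measurable_piecewise hG.continuousOn continuousOn_const
    (isOpen_lt continuous_const Complex.continuous_re).measurableSet

theorem horizontal_eq_indicator {G : ℂ → ℂ} {a b : ℝ} (ha : 0 < a) (hab : a ≤ b) (y : ℝ) :
    ∫ x in a..b, G ((x : ℂ) + (y : ℂ) * Complex.I) =
      ∫ x in Ioc a b, {z : ℂ | 0 < z.re}.indicator G ((x : ℂ) + (y : ℂ) * Complex.I) := by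
  rw [intervalIntegral.integral_of_le hab]
  refine setIntegral_congr_fun measurableSet_Ioc fun x hx => ?_
  have : (x : ℂ) + (y : ℂ) * Complex.I ∈ {z : ℂ | 0 < z.re} := by
    simpa using ha.trans hx.1
  simp only [indicator_of_mem this]

theorem measurable_horizontal {G : ℂ → ℂ} (hG : DifferentiableOn ℂ G {z : ℂ | 0 < z.re})
    {a b : ℝ} (ha : 0 < a) (hab : a ≤ b) :
    Measurable fun y : ℝ => ∫ x in a..b, G ((x : ℂ) + (y : ℂ) * Complex.I) := by
  simp_rw [horizontal_eq_indicator (G := G) ha hab]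
  have hm := (measurable_indicator_halfPlane hG).comp (by fun_prop : Measurable fun p : ℝ × ℝ =>
      (p.2 : ℂ) + (p.1 : ℂ) * Complex.I)
  exact (hm.stronglyMeasurable.integral_prod_right').measurable

theorem lintegral_horizontal_ne_top {G : ℂ → ℂ} (hG : DifferentiableOn ℂ G {z : ℂ | 0 < z.re})
    {B : ℝ≥0∞} (hB : B ≠ ∞)
    (hGB : ∀ x : ℝ, 0 < x → ∫⁻ y : ℝ, ‖G ((x : ℂ) + (y : ℂ) * Complex.I)‖ₑ ≤ B)
    {a b : ℝ} (ha : 0 < a) (hab : a ≤ b) :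
    ∫⁻ y : ℝ, ‖∫ x in a..b, G ((x : ℂ) + (y : ℂ) * Complex.I)‖ₑ ≠ ∞ := by
  have hm := measurable_indicator_halfPlane hG
  have hle : ∀ y : ℝ, ‖∫ x in a..b, G ((x : ℂ) + (y : ℂ) * Complex.I)‖ₑ ≤
      ∫⁻ x in Ioc a b, ‖{z : ℂ | 0 < z.re}.indicator G ((x : ℂ) + (y : ℂ) * Complex.I)‖ₑ := by
    intro y
    rw [horizontal_eq_indicator ha hab]
    exact enorm_integral_le_lintegral_enorm _
  refine ((lintegral_mono hle).trans_lt ?_).ne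
  rw [lintegral_lintegral_swap]
  · calc _ ≤ ∫⁻ _ in Ioc a b, B := by
          refine setLIntegral_mono' measurableSet_Ioc fun x hx => ?_
          refine (lintegral_mono fun y => ?_).trans (hGB x (ha.trans hx.1))
          exact enorm_indicator_le_enorm_self _ _
      _ < ∞ := by
          rw [setLIntegral_const]
          exact ENNReal.mul_lt_top hB.lt_top (by simp)
  · refine Measurable.aemeasurable ?_
    exact (hm.comp (by fun_prop : Measurable fun p : ℝ × ℝ =>
      (p.2 : ℂ) + (p.1 : ℂ) * Complex.I)).enorm

/-- Cauchy's theorem on [a, b] × [-T, T]. The horizontal contribution converges as T → ∞ because the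
vertical ones do, and it is integrable in T by Tonelli, so its limit is 0. -/
theorem integral_vertical_eq {G : ℂ → ℂ} (hG : DifferentiableOn ℂ G {z : ℂ | 0 < z.re})
    {B : ℝ≥0∞} (hB : B ≠ ∞)
    (hGB : ∀ x : ℝ, 0 < x → ∫⁻ y : ℝ, ‖G ((x : ℂ) + (y : ℂ) * Complex.I)‖ₑ ≤ B)
    {a b : ℝ} (ha : 0 < a) (hab : a ≤ b) :
    ∫ y : ℝ, G ((a : ℂ) + (y : ℂ) * Complex.I) = ∫ y : ℝ, G ((b : ℂ) + (y : ℂ) * Complex.I) := by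
  have hint : ∀ x : ℝ, 0 < x → Integrable fun y : ℝ => G ((x : ℂ) + (y : ℂ) * Complex.I) :=
    fun x hx => ⟨(continuous_vertical hG hx).aestronglyMeasurable, (hGB x hx).trans_lt hB.lt_top⟩
  have hvert : ∀ x : ℝ, 0 < x → Tendsto
      (fun T : ℝ => ∫ y in (-T)..T, G ((x : ℂ) + (y : ℂ) * Complex.I)) atTop
      (𝓝 (∫ y : ℝ, G ((x : ℂ) + (y : ℂ) * Complex.I))) := fun x hx =>
    intervalIntegral_tendsto_integral (hint x hx) tendsto_neg_atTop_atBot tendsto_id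
  have hb : 0 < b := ha.trans_le hab
  set h : ℝ → ℂ := fun T => (∫ x in a..b, G ((x : ℂ) + ((T : ℝ) : ℂ) * Complex.I)) -
    ∫ x in a..b, G ((x : ℂ) + ((-T : ℝ) : ℂ) * Complex.I) with hh
  have hrect : ∀ T : ℝ, h T = Complex.I • (∫ y in (-T)..T, G ((b : ℂ) + (y : ℂ) * Complex.I)) -
      Complex.I • ∫ y in (-T)..T, G ((a : ℂ) + (y : ℂ) * Complex.I) := by
    intro T
    have := Complex.integral_boundary_rect_eq_zero_of_differentiableOn G ⟨a, -T⟩ ⟨b, T⟩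
      (hG.mono fun z hz => by
        have h1 : z.re ∈ uIcc a b := hz.1
        rw [uIcc_of_le hab] at h1
        exact ha.trans_le h1.1)
    simp only at this
    rw [hh]
    simp only
    linear_combination -this
  have hlim : Tendsto h atTop (𝓝 (Complex.I • (∫ y : ℝ, G ((b : ℂ) + (y : ℂ) * Complex.I)) -
      Complex.I • ∫ y : ℝ, G ((a : ℂ) + (y : ℂ) * Complex.I))) := by
    rw [funext hrect]
    exact ((hvert b hb).const_smul _).sub ((hvert a ha).const_smul _)
  have hz := eq_zero_of_tendsto_of_lintegral_ne_top hlim (by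
    have hfin := lintegral_horizontal_ne_top hG hB hGB ha hab
    have hfin' : ∫⁻ T : ℝ, ‖∫ x in a..b, G ((x : ℂ) + ((-T : ℝ) : ℂ) * Complex.I)‖ₑ ≠ ∞ := by
      rwa [lintegral_neg_eq_self
        (fun y : ℝ => ‖∫ x in a..b, G ((x : ℂ) + (y : ℂ) * Complex.I)‖ₑ) (μ := volume)]
    refine ((lintegral_mono fun T => enorm_sub_le).trans_lt ?_).ne
    rw [lintegral_add_left (measurable_horizontal hG ha hab).enorm]
    exact ENNReal.add_lt_top.2 ⟨hfin.lt_top, hfin'.lt_top⟩)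
  rw [← smul_sub, smul_eq_zero, sub_eq_zero] at hz
  exact (hz.resolve_left Complex.I_ne_zero).symm

/-! ### Boundary functions come from `L²(0, 1)` -/

/-- The kernel `c^{-z-1/2} / (z + 1/2)`. -/
def tailKernel (c : ℝ) (z : ℂ) : ℂ := (c : ℂ) ^ (-z - 1 / 2) / (z + 1 / 2)

theorem differentiableOn_tailKernel {c : ℝ} (hc : 0 < c) :
    DifferentiableOn ℂ (tailKernel c) {z : ℂ | 0 < z.re} := by
  intro z hz
  have hc0 : (c : ℂ) ≠ 0 := by exact_mod_cast hc.ne'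
  refine DifferentiableAt.differentiableWithinAt ?_
  unfold tailKernel
  refine DifferentiableAt.div ?_ (by fun_prop) (add_half_ne_zero (le_of_lt hz))
  exact DifferentiableAt.const_cpow (by fun_prop) (Or.inl hc0)

theorem continuous_tailKernel {c : ℝ} (hc : 0 < c) {x : ℝ} (hx : 0 ≤ x) :
    Continuous fun y : ℝ => tailKernel c ((x : ℂ) + (y : ℂ) * Complex.I) := by
  have hc0 : (c : ℂ) ≠ 0 := by exact_mod_cast hc.ne'
  unfold tailKernel
  refine Continuous.div ?_ (by fun_prop) fun y => add_half_ne_zero (by simpa using hx)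
  exact Continuous.const_cpow (by fun_prop) (Or.inl hc0)

theorem normSq_add_half (x y : ℝ) :
    ‖(x : ℂ) + (y : ℂ) * Complex.I + 1 / 2‖ ^ 2 = (x + 1 / 2) ^ 2 + y ^ 2 := by
  rw [← Complex.normSq_eq_norm_sq, Complex.normSq_apply]
  simp
  ring

/-- Here c ≥ 1 is essential: it gives |c^{-z-1/2}| ≤ 1 on the closed right half plane. -/
theorem norm_tailKernel_sq_le {c : ℝ} (hc : 1 ≤ c) {x : ℝ} (hx : 0 ≤ x) (y : ℝ) :
    ‖tailKernel c ((x : ℂ) + (y : ℂ) * Complex.I)‖ ^ 2 ≤ ((x + 1 / 2) ^ 2 + y ^ 2)⁻¹ := by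
  have hc0 : 0 < c := one_pos.trans_le hc
  rw [tailKernel, norm_div, div_pow, normSq_add_half, div_eq_mul_inv]
  refine mul_le_of_le_one_left (by positivity) (pow_le_one₀ (norm_nonneg _) ?_)
  rw [Complex.norm_cpow_eq_rpow_re_of_pos hc0]
  refine Real.rpow_le_one_of_one_le_of_nonpos hc ?_
  simp
  linarith

/-- The constant 4 comes from (x + 1/2)² + y² ≥ (1 + y²)/4, which gives one integrable majorant for
all vertical lines. -/
theorem enorm_tailKernel_sq_le {c : ℝ} (hc : 1 ≤ c) {x : ℝ} (hx : 0 ≤ x) (y : ℝ) :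
    ‖tailKernel c ((x : ℂ) + (y : ℂ) * Complex.I)‖ₑ ^ 2 ≤
      ENNReal.ofReal (4 * (1 + y ^ 2)⁻¹) := by
  rw [← ofReal_norm, ← ENNReal.ofReal_pow (norm_nonneg _)]
  refine ENNReal.ofReal_le_ofReal ((norm_tailKernel_sq_le hc hx y).trans ?_)
  rw [← div_eq_mul_inv, inv_eq_one_div, div_le_div_iff₀ (by positivity) (by positivity)]
  nlinarith [sq_nonneg y, sq_nonneg x]

theorem lintegral_four_div_lt_top : ∫⁻ y : ℝ, ENNReal.ofReal (4 * (1 + y ^ 2)⁻¹) < ∞ :=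
  (integrable_inv_one_add_sq.const_mul 4).lintegral_lt_top

theorem eLpNorm_tailKernel_le {c : ℝ} (hc : 1 ≤ c) {x : ℝ} (hx : 0 ≤ x) :
    eLpNorm (fun y : ℝ => tailKernel c ((x : ℂ) + (y : ℂ) * Complex.I)) 2 volume ≤
      (∫⁻ y : ℝ, ENNReal.ofReal (4 * (1 + y ^ 2)⁻¹)) ^ (1 / 2 : ℝ) := by
  rw [eLpNorm_two_eq]
  exact ENNReal.rpow_le_rpow (lintegral_mono (enorm_tailKernel_sq_le hc hx)) (by norm_num)

theorem memLp_tailKernel {c : ℝ} (hc : 1 ≤ c) {x : ℝ} (hx : 0 ≤ x) :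
    MemLp (fun y : ℝ => tailKernel c ((x : ℂ) + (y : ℂ) * Complex.I)) 2 volume :=
  ⟨(continuous_tailKernel (one_pos.trans_le hc) hx).aestronglyMeasurable,
    (eLpNorm_tailKernel_le hc hx).trans_lt
      (ENNReal.rpow_lt_top_of_nonneg (by norm_num) lintegral_four_div_lt_top.ne)⟩

theorem tendsto_eLpNorm_tailKernel {c : ℝ} (hc : 1 ≤ c) :
    Tendsto (fun n : ℕ => eLpNorm (fun y : ℝ =>
      tailKernel c (((n : ℝ) : ℂ) + (y : ℂ) * Complex.I)) 2 volume) atTop (𝓝 0) := by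
  simp only [eLpNorm_two_eq]
  have key : Tendsto (fun n : ℕ => ∫⁻ y : ℝ,
      ‖tailKernel c (((n : ℝ) : ℂ) + (y : ℂ) * Complex.I)‖ₑ ^ 2) atTop
      (𝓝 (∫⁻ _ : ℝ, 0)) := by
    refine tendsto_lintegral_of_dominated_convergence _
      (fun n => ?_) (fun n => Eventually.of_forall (enorm_tailKernel_sq_le hc n.cast_nonneg))
      lintegral_four_div_lt_top.ne (Eventually.of_forall fun y => ?_)
    · exact (continuous_tailKernel (one_pos.trans_le hc) n.cast_nonneg).measurable.enorm.pow_const 2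
    · have h1 : Tendsto (fun n : ℕ => ENNReal.ofReal (n : ℝ)⁻¹) atTop (𝓝 0) := by
        have := ENNReal.tendsto_ofReal (tendsto_inv_atTop_nhds_zero_nat (𝕜 := ℝ))
        simpa using this
      refine tendsto_of_tendsto_of_tendsto_of_le_of_le' tendsto_const_nhds h1
        (Eventually.of_forall fun n => zero_le) ?_
      filter_upwards [eventually_ge_atTop 1] with n hn
      have hn' : (1 : ℝ) ≤ n := by exact_mod_cast hn
      rw [← ofReal_norm, ← ENNReal.ofReal_pow (norm_nonneg _)]
      refine ENNReal.ofReal_le_ofReal ((norm_tailKernel_sq_le hc n.cast_nonneg y).trans ?_)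
      refine inv_anti₀ (by positivity) ?_
      nlinarith [sq_nonneg y]
  have := key.ennrpow_const (1 / 2 : ℝ)
  simpa using this

theorem norm_tailKernel_le {c : ℝ} (hc : 1 ≤ c) {x : ℝ} (hx : 0 ≤ x) (y : ℝ) :
    ‖tailKernel c ((x : ℂ) + (y : ℂ) * Complex.I)‖ ≤ ‖tailKernel c ((y : ℂ) * Complex.I)‖ := by
  have hc0 : 0 < c := one_pos.trans_le hc
  rw [tailKernel, tailKernel, norm_div, norm_div, Complex.norm_cpow_eq_rpow_re_of_pos hc0,
    Complex.norm_cpow_eq_rpow_re_of_pos hc0]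
  refine div_le_div₀ (Real.rpow_nonneg hc0.le _) (Real.rpow_le_rpow_of_exponent_le hc ?_)
    (norm_pos_iff.2 (add_half_ne_zero (by simp))) ?_
  · simpa using hx
  · rw [← sq_le_sq₀ (norm_nonneg _) (norm_nonneg _), normSq_add_half]
    have := normSq_add_half 0 y
    simp only [Complex.ofReal_zero, zero_add] at this
    rw [this]
    nlinarith

theorem tailKernel_ne_zero {c : ℝ} (hc : 0 < c) {z : ℂ} (hz : 0 ≤ z.re) : tailKernel c z ≠ 0 := by
  have hc0 : (c : ℂ) ≠ 0 := by exact_mod_cast hc.ne'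
  exact div_ne_zero (by simp [Complex.cpow_eq_zero_iff, hc0]) (add_half_ne_zero hz)

theorem IsHardyFunction.exists_bound {F : ℂ → ℂ} (hF : IsHardyFunction F) :
    ∃ C : ℝ≥0∞, C ≠ ∞ ∧ ∀ x : ℝ, 0 < x →
      eLpNorm (fun y : ℝ => F ((x : ℂ) + (y : ℂ) * Complex.I)) 2 volume ≤ C := by
  refine ⟨_, (ENNReal.rpow_lt_top_of_nonneg (by norm_num : (0 : ℝ) ≤ 1 / 2) hF.2.ne).ne,
    fun x hx => ?_⟩
  rw [eLpNorm_two_eq]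
  refine ENNReal.rpow_le_rpow ?_ (by norm_num)
  exact le_iSup₂ (f := fun (x : ℝ) (_ : 0 < x) =>
    ∫⁻ y : ℝ, ‖F ((x : ℂ) + (y : ℂ) * Complex.I)‖ₑ ^ 2) x hx

/-- The integral can be moved to the line Re z = n, where Cauchy–Schwarz bounds it by a constant
times the L² norm of the kernel, which tends to 0. -/
theorem IsHardyFunction.integral_mul_tailKernel_eq_zero {F : ℂ → ℂ} (hF : IsHardyFunction F)
    {c : ℝ} (hc : 1 ≤ c) {x : ℝ} (hx : 0 < x) :
    ∫ y : ℝ, F ((x : ℂ) + (y : ℂ) * Complex.I) * tailKernel c ((x : ℂ) + (y : ℂ) * Complex.I) =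
      0 := by
  obtain ⟨C, hC, hFC⟩ := hF.exists_bound
  have hc0 : 0 < c := one_pos.trans_le hc
  set D : ℝ≥0∞ := (∫⁻ y : ℝ, ENNReal.ofReal (4 * (1 + y ^ 2)⁻¹)) ^ (1 / 2 : ℝ) with hD
  have hDtop : D ≠ ∞ :=
    (ENNReal.rpow_lt_top_of_nonneg (by norm_num) lintegral_four_div_lt_top.ne).ne
  have hbound : ∀ x : ℝ, 0 < x → ∫⁻ y : ℝ, ‖F ((x : ℂ) + (y : ℂ) * Complex.I) *
      tailKernel c ((x : ℂ) + (y : ℂ) * Complex.I)‖ₑ ≤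
      C * eLpNorm (fun y : ℝ => tailKernel c ((x : ℂ) + (y : ℂ) * Complex.I)) 2 volume := by
    intro x hx
    rw [← eLpNorm_one_eq_lintegral_enorm]
    refine (eLpNorm_mul_one_le (continuous_vertical hF.1 hx).aestronglyMeasurable
      (continuous_tailKernel hc0 hx.le).aestronglyMeasurable).trans ?_
    gcongr
    exact hFC x hx
  have hG : DifferentiableOn ℂ (fun z => F z * tailKernel c z) {z : ℂ | 0 < z.re} :=
    hF.1.mul (differentiableOn_tailKernel hc0)
  have hconst : ∀ᶠ n : ℕ in atTop,
      ‖∫ y : ℝ, F ((x : ℂ) + (y : ℂ) * Complex.I) *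
        tailKernel c ((x : ℂ) + (y : ℂ) * Complex.I)‖ₑ ≤
      C * eLpNorm (fun y : ℝ => tailKernel c (((n : ℝ) : ℂ) + (y : ℂ) * Complex.I)) 2 volume := by
    filter_upwards [tendsto_natCast_atTop_atTop.eventually_ge_atTop x] with n hn
    rw [integral_vertical_eq hG (ENNReal.mul_ne_top hC hDtop)
      (fun x hx => (hbound x hx).trans (by gcongr; exact eLpNorm_tailKernel_le hc hx.le)) hx hn]
    exact (enorm_integral_le_lintegral_enorm _).trans (hbound n (hx.trans_le hn))
  have hlim := ENNReal.Tendsto.const_mul (tendsto_eLpNorm_tailKernel hc)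
    (Or.inr hC : (0 : ℝ≥0∞) ≠ 0 ∨ C ≠ ∞)
  rw [mul_zero] at hlim
  have := ge_of_tendsto hlim hconst
  exact enorm_eq_zero.1 (le_zero_iff.1 this)

theorem IsHardyFunction.integral_boundary_mul_tailKernel {F : ℂ → ℂ} (hF : IsHardyFunction F)
    {g : ℝ → ℂ} (hg : MemLp g 2 volume)
    (hlim : ∀ᵐ y : ℝ, Tendsto (fun x : ℝ => F ((x : ℂ) + (y : ℂ) * Complex.I)) (𝓝[>] 0) (𝓝 (g y)))
    {c : ℝ} (hc : 1 ≤ c) :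
    ∫ y : ℝ, g y * tailKernel c ((y : ℂ) * Complex.I) = 0 := by
  obtain ⟨C, hC, hFC⟩ := hF.exists_bound
  have hc0 : 0 < c := one_pos.trans_le hc
  set x : ℕ → ℝ := fun n => 1 / ((n : ℝ) + 1) with hx
  have hxpos : ∀ n, 0 < x n := fun n => by rw [hx]; positivity
  have hx0 : Tendsto x atTop (𝓝[>] 0) :=
    tendsto_nhdsWithin_iff.2 ⟨tendsto_one_div_add_atTop_nhds_zero_nat,
      Eventually.of_forall hxpos⟩
  have hK0 : ∀ y : ℝ, tailKernel c ((y : ℂ) * Complex.I) ≠ 0 := fun y =>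
    tailKernel_ne_zero hc0 (by simp)
  have hKc : Continuous fun y : ℝ => tailKernel c ((y : ℂ) * Complex.I) := by
    simpa using continuous_tailKernel hc0 le_rfl
  have hKm : MemLp (fun y : ℝ => tailKernel c ((y : ℂ) * Complex.I)) 2 volume := by
    simpa using memLp_tailKernel hc le_rfl
  -- The kernel on the shifted line is divided by its boundary value, so that weak convergence can
  -- be applied against a fixed L² function. The quotient has modulus at most 1 and tends to 1, so
  -- neither the L² bound nor the limit changes.
  set f : ℕ → ℝ → ℂ := fun n y => F ((x n : ℂ) + (y : ℂ) * Complex.I) *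
    (tailKernel c ((x n : ℂ) + (y : ℂ) * Complex.I) / tailKernel c ((y : ℂ) * Complex.I)) with hf
  have hconv := tendsto_integral_mul_of_ae_tendsto (f := f) hC (fun n => ?_) (fun n => ?_) hg hKm ?_
  · have hzero : ∀ n, ∫ y, f n y * tailKernel c ((y : ℂ) * Complex.I) = 0 := fun n => by
      rw [← hF.integral_mul_tailKernel_eq_zero hc (hxpos n)]
      refine integral_congr_ae (Eventually.of_forall fun y => ?_)
      simp only [hf]
      rw [mul_assoc, div_mul_cancel₀ _ (hK0 y)]
    simp only [hzero] at hconv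
    exact (tendsto_nhds_unique hconv tendsto_const_nhds)
  · exact ((continuous_vertical hF.1 (hxpos n)).mul
      ((continuous_tailKernel hc0 (hxpos n).le).div hKc hK0)).aestronglyMeasurable
  · refine (eLpNorm_mono fun y => ?_).trans (hFC (x n) (hxpos n))
    simp only [hf]
    rw [norm_mul, norm_div]
    refine mul_le_of_le_one_right (norm_nonneg _) (div_le_one_of_le₀ ?_ (norm_nonneg _))
    exact norm_tailKernel_le hc (hxpos n).le y
  · filter_upwards [hlim] with y hy
    have h1 := hy.comp hx0
    have h2 : Tendsto (fun x : ℝ => tailKernel c ((x : ℂ) + (y : ℂ) * Complex.I)) (𝓝[>] 0)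
        (𝓝 (tailKernel c ((y : ℂ) * Complex.I))) := by
      have hc' : (c : ℂ) ≠ 0 := by exact_mod_cast hc0.ne'
      have : ContinuousAt (fun x : ℝ => tailKernel c ((x : ℂ) + (y : ℂ) * Complex.I)) 0 := by
        unfold tailKernel
        refine ContinuousAt.div ?_ (by fun_prop) (add_half_ne_zero (by simp))
        exact ContinuousAt.const_cpow (by fun_prop) (Or.inl hc')
      have h3 := this.tendsto
      simp only [Complex.ofReal_zero, zero_add] at h3
      exact h3.mono_left nhdsWithin_le_nhds
    have h4 := h1.mul ((h2.comp hx0).div_const (tailKernel c ((y : ℂ) * Complex.I)))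
    rw [div_self (hK0 y), mul_one] at h4
    exact h4

theorem exists_extendZero_eq {f : L2Inf} (hf : ∀ᵐ t : ℝ, 1 < t → f t = 0) :
    ∃ h : L2One, extendZero h = f := by
  have hm : MemLp f 2 (volume.restrict (Ioo (0 : ℝ) 1)) :=
    (Lp.memLp f).mono_measure (Measure.restrict_mono_set _ fun _ h => h.1)
  refine ⟨hm.toLp f, Lp.ext ?_⟩
  refine (memLp_extend _).coeFn_toLp.trans ((extend_congr hm.coeFn_toLp).trans ?_)
  rw [EventuallyEq, ae_restrict_iff' measurableSet_Ioi]
  have h1 : ∀ᵐ t : ℝ, t ≠ 1 := by simp [ae_iff]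
  filter_upwards [hf, h1] with t ht h1 ht0
  by_cases h : t ∈ Ioo (0 : ℝ) 1
  · rw [indicator_of_mem h]
  · rw [indicator_of_notMem h, ht]
    exact lt_of_le_of_ne (not_lt.1 fun h' => h ⟨ht0, h'⟩) h1.symm

theorem conj_cpow_ofReal {c : ℝ} (hc : 0 < c) (w : ℂ) :
    (starRingEnd ℂ) ((c : ℂ) ^ w) = (c : ℂ) ^ ((starRingEnd ℂ) w) := by
  rw [Complex.cpow_conj _ _ (by rw [Complex.arg_ofReal_of_nonneg hc.le]; exact Real.pi_pos.ne),
    Complex.conj_ofReal]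

/-- On the axis the conjugate of the transform of `invTail c` is `tailKernel c` up to the factor
(2π)^{-1/2}. The vanishing boundary integrals are therefore orthogonality relations for the preimage
f. -/
theorem exists_mellinIso_extendZero_eq {g : L2Imag} (hg : g ∈ hardyPlus) :
    ∃ f : L2One, mellinIso (extendZero f) = g := by
  obtain ⟨F, hF, hlim⟩ := hg
  rw [ae_imagAxis_iff] at hlim
  have hgm : MemLp (fun y : ℝ => g ((y : ℂ) * Complex.I)) 2 volume :=
    (Lp.memLp g).comp_measurePreserving measurePreserving_toImag
  obtain ⟨f, rfl⟩ := mellinIso.surjective g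
  obtain ⟨h, rfl⟩ := exists_extendZero_eq (f := f) (ae_eq_zero_of_inner_invTail fun c hc => by
    have hc0 : 0 < c := one_pos.trans_le hc
    have h0 := hF.integral_boundary_mul_tailKernel hgm hlim hc
    rw [← mellinIso.inner_map_map, L2.inner_def, integral_imagAxis]
    have : ∀ᵐ y : ℝ, inner ℂ (mellinIso (invTail c hc0) ((y : ℂ) * Complex.I))
        (mellinIso f ((y : ℂ) * Complex.I)) = ((√(2 * Real.pi) : ℝ) : ℂ)⁻¹ *
          (mellinIso f ((y : ℂ) * Complex.I) * tailKernel c ((y : ℂ) * Complex.I)) := by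
      filter_upwards [ae_imagAxis_iff.1 (mellinIso_invTail hc0)] with y hy
      rw [hy, RCLike.inner_apply, map_mul, map_inv₀, Complex.conj_ofReal, map_div₀,
        conj_cpow_ofReal hc0, tailKernel]
      simp only [map_sub, map_mul, Complex.conj_ofReal, Complex.conj_I, map_div₀, map_one,
        map_ofNat, mul_neg, sub_neg_eq_add]
      rw [add_comm (1 / 2 : ℂ)]
      ring
    rw [integral_congr_ae this, integral_const_mul, h0, mul_zero])
  exact ⟨h, rfl⟩

/-! ### Almost everywhere convergence of Poisson integrals -/

theorem hasDerivAt_neg_inv_one_add_sq (r : ℝ) :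
    HasDerivAt (fun r : ℝ => -(1 + r ^ 2)⁻¹) (2 * r / (1 + r ^ 2) ^ 2) r := by
  have h : HasDerivAt (fun r : ℝ => 1 + r ^ 2) (2 * r) r := by
    simpa using (hasDerivAt_pow 2 r).const_add 1
  refine (h.inv (by positivity)).neg.congr_deriv ?_
  ring

theorem tendsto_inv_one_add_sq : Tendsto (fun r : ℝ => (1 + r ^ 2)⁻¹) atTop (𝓝 0) :=
  tendsto_inv_atTop_zero.comp (tendsto_atTop_add_const_left _ _ (tendsto_pow_atTop two_ne_zero))

theorem integrableOn_layer {a : ℝ} (ha : 0 ≤ a) :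
    IntegrableOn (fun r : ℝ => 2 * r / (1 + r ^ 2) ^ 2) (Ioi a) := by
  refine integrableOn_Ioi_deriv_of_nonneg' (fun r _ => hasDerivAt_neg_inv_one_add_sq r)
    (fun r hr => ?_) (l := 0) (by simpa using tendsto_inv_one_add_sq.neg)
  have : 0 < r := ha.trans_lt hr
  positivity

/-- With a = |v| this writes (1 + v²)⁻¹ as a positive superposition of indicators of the intervals
(-r, r), reducing Poisson integrals to averages over symmetric intervals. -/
theorem integral_layer {a : ℝ} (ha : 0 ≤ a) :
    ∫ r in Ioi a, 2 * r / (1 + r ^ 2) ^ 2 = (1 + a ^ 2)⁻¹ := by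
  rw [integral_Ioi_of_hasDerivAt_of_tendsto' (fun r _ => hasDerivAt_neg_inv_one_add_sq r)
    (integrableOn_layer ha) (by simpa using tendsto_inv_one_add_sq.neg)]
  ring

theorem integral_layer_mass :
    ∫ r in Ioi (0 : ℝ), 2 * r / (1 + r ^ 2) ^ 2 * (2 * r) = Real.pi := by
  have hd : ∀ r : ℝ, HasDerivAt (fun r : ℝ => 2 * (Real.arctan r - r * (1 + r ^ 2)⁻¹))
      (2 * r / (1 + r ^ 2) ^ 2 * (2 * r)) r := by
    intro r
    have h : HasDerivAt (fun r : ℝ => 1 + r ^ 2) (2 * r) r := by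
      simpa using (hasDerivAt_pow 2 r).const_add 1
    have h2 := (((Real.hasDerivAt_arctan r).sub ((hasDerivAt_id r).mul
      (h.inv (by positivity)))).const_mul 2)
    refine h2.congr_deriv ?_
    simp only [id, Pi.inv_apply]
    field_simp
    ring
  have ht : Tendsto (fun r : ℝ => 2 * (Real.arctan r - r * (1 + r ^ 2)⁻¹)) atTop
      (𝓝 (2 * (Real.pi / 2 - 0))) := by
    refine ((tendsto_nhds_of_tendsto_nhdsWithin Real.tendsto_arctan_atTop).sub ?_).const_mul 2
    refine squeeze_zero' (g := fun r : ℝ => r⁻¹) ?_ ?_ tendsto_inv_atTop_zero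
    · filter_upwards [eventually_ge_atTop 0] with r hr
      positivity
    · filter_upwards [eventually_gt_atTop 0] with r hr
      rw [← div_eq_mul_inv, div_le_iff₀ (by positivity)]
      have : r⁻¹ * (1 + r ^ 2) = r⁻¹ + r := by field_simp
      rw [this]
      have : 0 < r⁻¹ := by positivity
      linarith
  rw [integral_Ioi_of_hasDerivAt_of_nonneg' (fun r _ => hd r) (fun r hr => ?_) ht]
  · simp
    ring
  · have : 0 < r := hr
    positivity

theorem layer_mul_le (r : ℝ) : 2 * r / (1 + r ^ 2) ^ 2 * r ≤ 2 * (1 + r ^ 2)⁻¹ := by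
  rw [div_mul_eq_mul_div, ← div_eq_mul_inv, div_le_div_iff₀ (by positivity) (by positivity)]
  nlinarith [sq_nonneg r, sq_nonneg (r ^ 2)]

/-- For |u| < r the bound comes from differentiability at β. For |u| ≥ r, the inequality |g| ≤ 1 +
|g|² gives |u| + ‖g‖₂², and ‖g‖₂² ≤ (‖g‖₂²/r)|u|. -/
theorem exists_primitive_bound {g : ℝ → ℂ} (hg : MemLp g 2 volume) {β : ℝ}
    (hβ : HasDerivAt (fun x => ∫ t in β..x, g t) (g β) β) :
    ∃ C : ℝ, ∀ u, ‖∫ t in β..(β + u), g t‖ ≤ C * |u| := by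
  have hO := hβ.isBigO_sub
  obtain ⟨C₁, hC₁⟩ := hO.bound
  obtain ⟨r, hr, hball⟩ := Metric.eventually_nhds_iff.1 hC₁
  have hsq : Integrable (fun t => ‖g t‖ ^ 2) := (memLp_two_iff_integrable_sq_norm hg.1).1 hg
  have hS : 0 ≤ ∫ t, ‖g t‖ ^ 2 := integral_nonneg fun _ => by positivity
  refine ⟨max C₁ (1 + (∫ t, ‖g t‖ ^ 2) / r), fun u => ?_⟩
  rcases lt_or_ge |u| r with hu | hu
  · have h := hball (y := β + u) (by simpa [Real.dist_eq] using hu)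
    simp only [intervalIntegral.integral_same, sub_zero, add_sub_cancel_left,
      Real.norm_eq_abs] at h
    exact h.trans (by gcongr; exact le_max_left _ _)
  · have hint : IntegrableOn (fun t => 1 + ‖g t‖ ^ 2) (uIoc β (β + u)) :=
      Integrable.add (by simp [uIoc]) hsq.integrableOn
    have h1 : ‖∫ t in β..(β + u), g t‖ ≤ |u| + ∫ t, ‖g t‖ ^ 2 := by
      calc ‖∫ t in β..(β + u), g t‖ ≤ ∫ t in uIoc β (β + u), ‖g t‖ :=
            intervalIntegral.norm_integral_le_integral_norm_uIoc
        _ ≤ ∫ t in uIoc β (β + u), (1 + ‖g t‖ ^ 2) := by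
            refine integral_mono_of_nonneg (Eventually.of_forall fun _ => norm_nonneg _) hint
              (Eventually.of_forall fun t => ?_)
            simp only
            nlinarith [sq_nonneg (‖g t‖ - 1)]
        _ = |u| + ∫ t in uIoc β (β + u), ‖g t‖ ^ 2 := by
            rw [integral_add (by simp [uIoc]) hsq.integrableOn]
            congr 1
            simp [uIoc, Measure.real]
            rcases le_total 0 u with h | h <;> simp [h, abs_of_nonneg, abs_of_nonpos]
        _ ≤ _ := by
            refine add_le_add_right ?_ _
            exact setIntegral_le_integral hsq (Eventually.of_forall fun _ => by positivity)
    have h2 : ∫ t, ‖g t‖ ^ 2 ≤ (∫ t, ‖g t‖ ^ 2) / r * |u| := by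
      rw [div_mul_eq_mul_div, le_div_iff₀ hr]
      gcongr
    calc _ ≤ (1 + (∫ t, ‖g t‖ ^ 2) / r) * |u| := by linarith
      _ ≤ _ := by gcongr; exact le_max_right _ _

theorem memLp_inv_one_add_sq : MemLp (fun v : ℝ => (((1 + v ^ 2)⁻¹ : ℝ) : ℂ)) 2 volume := by
  have hc : Continuous fun v : ℝ => (((1 + v ^ 2)⁻¹ : ℝ) : ℂ) :=
    Complex.continuous_ofReal.comp
      (Continuous.inv₀ (by fun_prop) fun v => by positivity)
  rw [memLp_two_iff_integrable_sq_norm hc.aestronglyMeasurable]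
  refine integrable_inv_one_add_sq.mono' (hc.norm.pow 2).aestronglyMeasurable
    (Eventually.of_forall fun v => ?_)
  have h1 : (1 + v ^ 2)⁻¹ ≤ 1 := inv_le_one_of_one_le₀ (by nlinarith [sq_nonneg v])
  have h0 : 0 ≤ (1 + v ^ 2)⁻¹ := by positivity
  rw [Complex.norm_real, Real.norm_of_nonneg h0, Real.norm_of_nonneg (by positivity)]
  nlinarith

theorem memLp_comp_affine {g : ℝ → ℂ} (hg : MemLp g 2 volume) (β : ℝ) {x : ℝ} (hx : x ≠ 0) :
    MemLp (fun v => g (β + x * v)) 2 volume := by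
  have h1 : MemLp (fun y => g (β + y)) 2 volume :=
    hg.comp_measurePreserving (measurePreserving_add_left volume β)
  have hq : Measure.QuasiMeasurePreserving (fun v : ℝ => x * v) volume volume := by
    refine ⟨by fun_prop, ?_⟩
    rw [Real.map_volume_mul_left hx]
    exact Measure.smul_absolutelyContinuous
  have hm : AEStronglyMeasurable (fun v => g (β + x * v)) volume :=
    h1.1.comp_quasiMeasurePreserving hq
  rw [memLp_two_iff_integrable_sq_norm hm]
  have h2 := (memLp_two_iff_integrable_sq_norm h1.1).1 h1
  exact h2.comp_mul_left' hx

/-- The layer-cake representation of a Poisson integral. -/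
theorem integral_poisson_eq_layer {h : ℝ → ℂ} (hh : MemLp h 2 volume) :
    ∫ v, (((1 + v ^ 2)⁻¹ : ℝ) : ℂ) * h v =
      ∫ r in Ioi (0 : ℝ), ((2 * r / (1 + r ^ 2) ^ 2 : ℝ) : ℂ) * ∫ v in (-r)..r, h v := by
  set q : ℝ → ℝ := fun r => 2 * r / (1 + r ^ 2) ^ 2 with hq
  have hqm : Measurable q := by rw [hq]; fun_prop
  have hq0 : ∀ r ∈ Ioi (0 : ℝ), 0 ≤ q r := fun r hr => by
    have : 0 < r := hr
    simp only [hq]; positivity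
  set A : Set (ℝ × ℝ) := {p | |p.1| < p.2} with hA
  have hAm : MeasurableSet A := measurableSet_lt (by fun_prop) (by fun_prop)
  -- Fubini for Φ: integrating in r first restores the kernel (1 + v²)⁻¹, integrating in v first
  -- leaves integrals of h over (-r, r).
  set Φ : ℝ → ℝ → ℂ := fun v r => A.indicator (fun p => ((q p.2 : ℝ) : ℂ) * h p.1) (v, r) with hΦ
  have hsec : ∀ v, Φ v = (Ioi |v|).indicator fun r => ((q r : ℝ) : ℂ) * h v := by
    intro v
    funext r
    simp only [hΦ, indicator, hA, mem_ofPred_eq, mem_Ioi]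
  have hsecn : ∀ v, (fun r => ‖Φ v r‖) = (Ioi |v|).indicator fun r => |q r| * ‖h v‖ := by
    intro v
    funext r
    rw [hsec]
    by_cases hr : r ∈ Ioi |v|
    · simp only [indicator_of_mem hr]; simp
    · simp only [indicator_of_notMem hr]; simp
  have hsub : ∀ v : ℝ, Ioi |v| ⊆ Ioi 0 := fun v => Ioi_subset_Ioi (abs_nonneg v)
  have hm : AEStronglyMeasurable (Function.uncurry Φ)
      (volume.prod (volume.restrict (Ioi (0 : ℝ)))) := by
    have h1 : AEStronglyMeasurable (fun p : ℝ × ℝ => h p.1)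
      (volume.prod (volume.restrict (Ioi (0 : ℝ)))) := hh.1.comp_fst
    have h2 : AEStronglyMeasurable (fun p : ℝ × ℝ => ((q p.2 : ℝ) : ℂ))
      (volume.prod (volume.restrict (Ioi (0 : ℝ)))) :=
      (by fun_prop : Measurable fun p : ℝ × ℝ => ((q p.2 : ℝ) : ℂ)).aestronglyMeasurable
    exact (h2.mul h1).indicator hAm
  have hint : Integrable (Function.uncurry Φ) (volume.prod (volume.restrict (Ioi (0 : ℝ)))) := by
    rw [integrable_prod_iff hm]
    refine ⟨Eventually.of_forall fun v => ?_, ?_⟩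
    · change Integrable (Φ v) _
      rw [hsec]
      refine Integrable.integrableOn ?_
      rw [integrable_indicator_iff measurableSet_Ioi]
      exact (Integrable.ofReal (integrableOn_layer (abs_nonneg v))).mul_const _
    · have : (fun v => ∫ r in Ioi 0, ‖Function.uncurry Φ (v, r)‖) =
          fun v => (1 + v ^ 2)⁻¹ * ‖h v‖ := by
        funext v
        change ∫ r in Ioi 0, ‖Φ v r‖ = _
        rw [hsecn, setIntegral_indicator measurableSet_Ioi, inter_eq_right.2 (hsub v),
          integral_mul_const]
        congr 1
        rw [← sq_abs v, ← integral_layer (abs_nonneg v)]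
        exact setIntegral_congr_fun measurableSet_Ioi fun r hr => abs_of_nonneg (hq0 r (hsub v hr))
      rw [this]
      have h3 := (memLp_inv_one_add_sq.integrable_mul hh).norm
      refine h3.congr (Eventually.of_forall fun v => ?_)
      simp only [Pi.mul_apply, norm_mul, Complex.norm_real]
      rw [Real.norm_of_nonneg (by positivity)]
  have hswap := integral_integral_swap (f := Φ) hint
  have hl : ∀ v, ∫ r in Ioi 0, Φ v r = (((1 + v ^ 2)⁻¹ : ℝ) : ℂ) * h v := by
    intro v
    rw [hsec, setIntegral_indicator measurableSet_Ioi, inter_eq_right.2 (hsub v),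
      integral_mul_const]
    congr 1
    rw [← sq_abs v, ← integral_layer (abs_nonneg v)]
    exact integral_ofReal
  have hr : ∀ r ∈ Ioi (0 : ℝ), ∫ v, Φ v r = ((q r : ℝ) : ℂ) * ∫ v in (-r)..r, h v := by
    intro r hr
    have hr : 0 < r := hr
    have : (fun v => Φ v r) = (Ioo (-r) r).indicator fun v => ((q r : ℝ) : ℂ) * h v := by
      funext v
      simp only [hΦ, indicator, hA, mem_ofPred_eq, mem_Ioo, abs_lt]
    rw [this, integral_indicator measurableSet_Ioo, integral_const_mul,
      intervalIntegral.integral_of_le (by linarith), integral_Ioc_eq_integral_Ioo]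
  simp_rw [hl] at hswap
  rw [hswap]
  exact setIntegral_congr_fun measurableSet_Ioi hr

/-- In layer form the inner integral is x⁻¹(N(xr) - N(-xr)) with N the primitive of g based at β; it
tends to 2r g(β). The linear bound on N dominates it by 2Cr, so the layered integrand is at most
4C(1 + r²)⁻¹, and the limiting mass is π. -/
theorem tendsto_poisson {g : ℝ → ℂ} (hg : MemLp g 2 volume) {β : ℝ}
    (hβ : HasDerivAt (fun x => ∫ t in β..x, g t) (g β) β) :
    Tendsto (fun x : ℝ => ∫ v, (((1 + v ^ 2)⁻¹ : ℝ) : ℂ) * g (β + x * v)) (𝓝[>] 0)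
      (𝓝 (Real.pi * g β)) := by
  obtain ⟨C, hC⟩ := exists_primitive_bound hg hβ
  have hloc : ∀ a b, IntervalIntegrable g volume a b := fun a b =>
    (LocallyIntegrable.integrableOn_isCompact (hg.locallyIntegrable (by norm_num))
      isCompact_uIcc).intervalIntegrable
  set N : ℝ → ℂ := fun u => ∫ t in β..(β + u), g t with hN
  have hNc : Continuous N :=
    (intervalIntegral.continuous_primitive hloc β).comp (by fun_prop)
  have hNd : HasDerivAt N (g β) 0 := by
    exact HasDerivAt.comp_const_add β 0 (f := fun x => ∫ t in β..x, g t) (by simpa using hβ)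
  have hD : ∀ x : ℝ, 0 < x → ∀ r : ℝ, ∫ v in (-r)..r, g (β + x * v) =
      x⁻¹ • (N (x * r) - N (x * -r)) := by
    intro x hx r
    rw [intervalIntegral.integral_comp_add_mul (fun y => g y) hx.ne' β]
    congr 1
    simp only [hN]
    rw [intervalIntegral.integral_interval_sub_left (hloc _ _) (hloc _ _)]
  have hpt : ∀ r : ℝ, Tendsto (fun x : ℝ => x⁻¹ • (N (x * r) - N (x * -r))) (𝓝[>] 0)
      (𝓝 (((2 * r : ℝ) : ℂ) * g β)) := by
    intro r
    have hcomp : ∀ r : ℝ, HasDerivAt (fun x : ℝ => N (x * r)) (r • g β) 0 := fun r => by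
      have h1 : HasDerivAt (fun x : ℝ => x * r) r 0 := by
        simpa using (hasDerivAt_id (0 : ℝ)).mul_const r
      have h2 : HasDerivAt N (g β) ((fun x : ℝ => x * r) 0) := by simpa using hNd
      exact h2.scomp 0 h1
    have h3 := ((hcomp r).sub (hcomp (-r))).tendsto_slope_zero_right
    have h4 : r • g β - (-r) • g β = ((2 * r : ℝ) : ℂ) * g β := by
      simp [Complex.real_smul]; ring
    rw [h4] at h3
    refine h3.congr fun x => ?_
    simp
  have hev : ∀ᶠ x : ℝ in 𝓝[>] 0, ∫ r in Ioi (0 : ℝ), ((2 * r / (1 + r ^ 2) ^ 2 : ℝ) : ℂ) *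
      (x⁻¹ • (N (x * r) - N (x * -r))) = ∫ v, (((1 + v ^ 2)⁻¹ : ℝ) : ℂ) * g (β + x * v) := by
    filter_upwards [self_mem_nhdsWithin] with x hx
    have hx : 0 < x := hx
    rw [integral_poisson_eq_layer (memLp_comp_affine hg β hx.ne')]
    simp_rw [hD x hx]
  have hlimit : ∫ r in Ioi (0 : ℝ), ((2 * r / (1 + r ^ 2) ^ 2 : ℝ) : ℂ) *
      (((2 * r : ℝ) : ℂ) * g β) = Real.pi * g β := by
    simp_rw [← mul_assoc, ← Complex.ofReal_mul]
    rw [integral_mul_const, integral_complex_ofReal, integral_layer_mass]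
  rw [← hlimit]
  refine Tendsto.congr' hev ?_
  refine tendsto_integral_filter_of_dominated_convergence
    (fun r => 4 * C * (1 + r ^ 2)⁻¹) ?_ ?_ ?_ ?_
  · refine Eventually.of_forall fun x => ?_
    refine AEStronglyMeasurable.mul (Measurable.aestronglyMeasurable (by fun_prop)) ?_
    exact (by fun_prop : Continuous fun r => x⁻¹ • (N (x * r) - N (x * -r))).aestronglyMeasurable
  · filter_upwards [self_mem_nhdsWithin] with x hx
    have hx : 0 < x := hx
    filter_upwards [ae_restrict_mem measurableSet_Ioi] with r hr
    have hr : 0 < r := hr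
    have hC0 : 0 ≤ C := by
      have := (norm_nonneg _).trans (hC 1)
      simpa using this
    have h1 : ‖x⁻¹ • (N (x * r) - N (x * -r))‖ ≤ 2 * C * r := by
      rw [norm_smul, norm_inv, Real.norm_of_nonneg hx.le]
      have h2 := hC (x * r)
      have h3 := hC (x * -r)
      rw [abs_of_nonneg (by positivity)] at h2
      rw [mul_neg, abs_neg, abs_of_nonneg (by positivity)] at h3
      have h4 : ‖N (x * r) - N (x * -r)‖ ≤ 2 * C * (x * r) := by
        refine (norm_sub_le _ _).trans ?_
        rw [mul_neg]
        simp only [hN]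
        linarith
      calc x⁻¹ * ‖N (x * r) - N (x * -r)‖ ≤ x⁻¹ * (2 * C * (x * r)) := by gcongr
        _ = 2 * C * r := by field_simp
    rw [norm_mul, Complex.norm_real, Real.norm_of_nonneg (by positivity)]
    calc _ ≤ 2 * r / (1 + r ^ 2) ^ 2 * (2 * C * r) := by gcongr
      _ = 2 * C * (2 * r / (1 + r ^ 2) ^ 2 * r) := by ring
      _ ≤ 2 * C * (2 * (1 + r ^ 2)⁻¹) :=
        mul_le_mul_of_nonneg_left (layer_mul_le r) (by positivity)
      _ = _ := by ring
  · exact (integrable_inv_one_add_sq.const_mul _).integrableOn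
  · exact Eventually.of_forall fun r => (hpt r).const_mul _

theorem integral_poisson_rescale (g : ℝ → ℂ) (β : ℝ) {x : ℝ} (hx : 0 < x) :
    ∫ y, ((x / (x ^ 2 + (y - β) ^ 2) : ℝ) : ℂ) * g y =
      ∫ v, (((1 + v ^ 2)⁻¹ : ℝ) : ℂ) * g (β + x * v) := by
  set G : ℝ → ℂ := fun y => ((x / (x ^ 2 + (y - β) ^ 2) : ℝ) : ℂ) * g y with hG
  have h1 : ∫ v, G (β + x * v) = |x⁻¹| • ∫ y, G y := by
    rw [Measure.integral_comp_mul_left (fun y => G (β + y)) x, integral_add_left_eq_self G β]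
  have h2 : ∀ v, (((1 + v ^ 2)⁻¹ : ℝ) : ℂ) * g (β + x * v) = (x : ℂ) * G (β + x * v) := by
    intro v
    simp only [hG]
    rw [← mul_assoc, ← Complex.ofReal_mul]
    congr 2
    rw [add_sub_cancel_left]
    field_simp
  simp_rw [h2]
  rw [integral_const_mul, h1, abs_of_pos (inv_pos.2 hx), Complex.real_smul, ← mul_assoc,
    ← Complex.ofReal_mul, mul_inv_cancel₀ hx.ne', Complex.ofReal_one, one_mul]

theorem ae_tendsto_poisson {g : ℝ → ℂ} (hg : MemLp g 2 volume) :
    ∀ᵐ β : ℝ, Tendsto (fun x : ℝ => (Real.pi : ℂ)⁻¹ *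
      ∫ y, ((x / (x ^ 2 + (y - β) ^ 2) : ℝ) : ℂ) * g y) (𝓝[>] 0) (𝓝 (g β)) := by
  filter_upwards [LocallyIntegrable.ae_hasDerivAt_integral
    (hg.locallyIntegrable (by norm_num))] with β hβ
  have h := (tendsto_poisson hg (hβ β)).const_mul (Real.pi : ℂ)⁻¹
  rw [inv_mul_cancel_left₀ (by exact_mod_cast Real.pi_ne_zero)] at h
  refine h.congr' ?_
  filter_upwards [self_mem_nhdsWithin] with x hx
  rw [integral_poisson_rescale g β hx]

/-! ### Mellin transforms of functions on the unit interval -/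

theorem memLp_rpow_unit {a : ℝ} (ha : -1 / 2 < a) :
    MemLp (fun t : ℝ => t ^ a) 2 (volume.restrict (Ioo (0 : ℝ) 1)) := by
  rw [memLp_two_iff_integrable_sq_norm (Measurable.aestronglyMeasurable (by fun_prop))]
  have h : IntegrableOn (fun t : ℝ => t ^ (2 * a)) (Ioo 0 1) := by
    rw [intervalIntegral.integrableOn_Ioo_rpow_iff one_pos]
    linarith
  refine h.congr_fun (fun t ht => ?_) measurableSet_Ioo
  have ht0 : 0 < t := ht.1
  simp only
  rw [Real.norm_of_nonneg (by positivity), ← Real.rpow_natCast, ← Real.rpow_mul ht0.le]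
  congr 1
  push_cast
  ring

theorem integrableOn_norm_mul_rpow (f : L2One) {a : ℝ} (ha : -1 / 2 < a) :
    IntegrableOn (fun t : ℝ => ‖f t‖ * t ^ a) (Ioo 0 1) :=
  (Lp.memLp f).norm.integrable_mul (memLp_rpow_unit ha)

/-- The analytic continuation `z ↦ (2π)^{-1/2} ∫₀¹ f(t) t^{z - 1/2} dt` of the modified Mellin
transform of a function on `(0, 1)`. -/
def mellinExt (f : L2One) (z : ℂ) : ℂ :=
  ((√(2 * Real.pi) : ℝ) : ℂ)⁻¹ * ∫ t in Ioo (0 : ℝ) 1, f t * (t : ℂ) ^ (z - 1 / 2)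

theorem aestronglyMeasurable_mul_cpow (f : L2One) (z : ℂ) :
    AEStronglyMeasurable (fun t : ℝ => f t * (t : ℂ) ^ z) (volume.restrict (Ioo 0 1)) :=
  (Lp.aestronglyMeasurable f).mul (Measurable.aestronglyMeasurable (by fun_prop))

theorem integrableOn_mul_cpow (f : L2One) {z : ℂ} (hz : 0 < z.re) :
    IntegrableOn (fun t : ℝ => f t * (t : ℂ) ^ (z - 1 / 2)) (Ioo 0 1) := by
  refine Integrable.mono' (integrableOn_norm_mul_rpow f (a := z.re - 1 / 2) (by linarith))
    (aestronglyMeasurable_mul_cpow f _) ?_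
  filter_upwards [ae_restrict_mem measurableSet_Ioo] with t ht
  rw [norm_mul, Complex.norm_cpow_eq_rpow_re_of_pos ht.1]
  simp

theorem differentiableOn_mellinExt (f : L2One) :
    DifferentiableOn ℂ (mellinExt f) {z : ℂ | 0 < z.re} := by
  intro z₀ hz₀
  have hz₀ : 0 < z₀.re := hz₀
  refine DifferentiableAt.differentiableWithinAt ?_
  unfold mellinExt
  refine DifferentiableAt.const_mul ?_ _
  -- Near z₀ one has Re z > 2δ. One δ absorbs the logarithm through |log t| t^δ ≤ δ⁻¹; the other
  -- leaves t^{δ-1/2}, which is integrable against f.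
  set δ : ℝ := z₀.re / 4 with hδ
  have hδ0 : 0 < δ := by positivity
  have hs : {z : ℂ | 2 * δ < z.re} ∈ 𝓝 z₀ :=
    (isOpen_lt continuous_const Complex.continuous_re).mem_nhds (by
      change 2 * δ < z₀.re
      rw [hδ]; linarith)
  refine (hasDerivAt_integral_of_dominated_loc_of_deriv_le (𝕜 := ℂ) hs
    (F := fun (z : ℂ) (t : ℝ) => f t * (t : ℂ) ^ (z - 1 / 2))
    (F' := fun (z : ℂ) (t : ℝ) => f t * ((t : ℂ) ^ (z - 1 / 2) * Complex.log t))
    (bound := fun t : ℝ => δ⁻¹ * (‖f t‖ * t ^ (δ - 1 / 2)))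
    (Eventually.of_forall fun z => aestronglyMeasurable_mul_cpow f _)
    (integrableOn_mul_cpow f hz₀) ?_ ?_ ?_ ?_).2.differentiableAt
  · exact (Lp.aestronglyMeasurable f).mul (Measurable.aestronglyMeasurable (by fun_prop))
  · filter_upwards [ae_restrict_mem measurableSet_Ioo] with t ht z hz
    have ht0 : 0 < t := ht.1
    have hz : 2 * δ < z.re := hz
    rw [norm_mul, norm_mul, Complex.norm_cpow_eq_rpow_re_of_pos ht0,
      ← Complex.ofReal_log ht0.le, Complex.norm_real, Real.norm_eq_abs]
    have h1 : t ^ (z - 1 / 2).re ≤ t ^ (δ - 1 / 2 + δ) :=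
      Real.rpow_le_rpow_of_exponent_ge ht0 ht.2.le (by simp; linarith)
    have h2 := (Real.abs_log_mul_self_rpow_lt t δ ht0 ht.2.le hδ0).le
    rw [abs_mul, abs_of_nonneg (Real.rpow_nonneg ht0.le _), one_div] at h2
    calc ‖f t‖ * (t ^ (z - 1 / 2).re * |Real.log t|)
        ≤ ‖f t‖ * (t ^ (δ - 1 / 2 + δ) * |Real.log t|) := by gcongr
      _ = ‖f t‖ * (t ^ (δ - 1 / 2) * (|Real.log t| * t ^ δ)) := by
          rw [Real.rpow_add ht0]; ring
      _ ≤ ‖f t‖ * (t ^ (δ - 1 / 2) * δ⁻¹) := by gcongr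
      _ = _ := by ring
  · exact (integrableOn_norm_mul_rpow f (by linarith)).const_mul _
  · filter_upwards [ae_restrict_mem measurableSet_Ioo] with t ht z _
    have ht0 : (t : ℂ) ≠ 0 := by exact_mod_cast ht.1.ne'
    refine HasDerivAt.const_mul _ ?_
    have h := ((hasDerivAt_id z).sub_const (1 / 2 : ℂ)).const_cpow (c := (t : ℂ)) (Or.inl ht0)
    simpa using h

theorem extendZero_ae (f : L2One) :
    extendZero f =ᵐ[volume.restrict (Ioi (0 : ℝ))] (Ioo (0 : ℝ) 1).indicator f :=
  (memLp_extend f).coeFn_toLp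

theorem memLp_damped (f : L2One) {x : ℝ} (hx : 0 < x) :
    MemLp ((Ioo (0 : ℝ) 1).indicator fun t => f t * ((t ^ x : ℝ) : ℂ)) 2
        (volume.restrict (Ioi (0 : ℝ))) ∧
      eLpNorm ((Ioo (0 : ℝ) 1).indicator fun t => f t * ((t ^ x : ℝ) : ℂ)) 2
        (volume.restrict (Ioi (0 : ℝ))) ≤ eLpNorm f 2 (volume.restrict (Ioo 0 1)) := by
  have hle : eLpNorm ((Ioo (0 : ℝ) 1).indicator fun t => f t * ((t ^ x : ℝ) : ℂ)) 2
      (volume.restrict (Ioi (0 : ℝ))) ≤ eLpNorm f 2 (volume.restrict (Ioo 0 1)) := by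
    rw [← eLpNorm_extend]
    refine eLpNorm_mono fun t => ?_
    by_cases h : t ∈ Ioo (0 : ℝ) 1
    · simp only [indicator_of_mem h, norm_mul, Complex.norm_real]
      refine mul_le_of_le_one_right (norm_nonneg _) ?_
      rw [Real.norm_of_nonneg (Real.rpow_nonneg h.1.le _)]
      exact Real.rpow_le_one h.1.le h.2.le hx.le
    · simp only [indicator_of_notMem h, le_refl]
  refine ⟨⟨?_, hle.trans_lt (Lp.memLp f).2⟩, hle⟩
  exact (((Lp.stronglyMeasurable f).mul (Measurable.stronglyMeasurable
    (by fun_prop))).indicator measurableSet_Ioo).aestronglyMeasurable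

theorem integrableOn_damped (f : L2One) {x : ℝ} (hx : 0 < x) :
    IntegrableOn (fun t : ℝ => (Ioo (0 : ℝ) 1).indicator (fun t => f t * ((t ^ x : ℝ) : ℂ)) t *
      ((t ^ (-1 / 2 : ℝ) : ℝ) : ℂ)) (Ioi 0) := by
  have h := integrableOn_mul_cpow f (z := (x : ℂ)) (by simpa using hx)
  refine ((integrable_indicator_iff measurableSet_Ioo).2 h).integrableOn.congr_fun
    (fun t ht => ?_) measurableSet_Ioi
  have ht : 0 < t := ht
  by_cases h : t ∈ Ioo (0 : ℝ) 1
  · simp only [indicator_of_mem h]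
    rw [mul_assoc, ← Complex.ofReal_mul, ← Real.rpow_add ht, Complex.ofReal_cpow ht.le]
    congr 2
    push_cast
    ring
  · simp [indicator_of_notMem h]

/-- On the line Re z = x the extension is the boundary transform of t^x f(t), and t^x ≤ 1 on (0, 1),
so Plancherel gives a bound independent of x. -/
theorem lintegral_mellinExt_le (f : L2One) {x : ℝ} (hx : 0 < x) :
    ∫⁻ y : ℝ, ‖mellinExt f ((x : ℂ) + (y : ℂ) * Complex.I)‖ₑ ^ 2 ≤
      eLpNorm f 2 (volume.restrict (Ioo 0 1)) ^ 2 := by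
  obtain ⟨hm, hle⟩ := memLp_damped f hx
  have hae := ae_imagAxis_iff.1
    (mellinIso_eq_integral hm.coeFn_toLp (integrableOn_damped f hx))
  have h1 : ∀ᵐ y : ℝ, ‖mellinExt f ((x : ℂ) + (y : ℂ) * Complex.I)‖ₑ ^ 2 =
      ‖mellinIso (hm.toLp _) ((y : ℂ) * Complex.I)‖ₑ ^ 2 := by
    filter_upwards [hae] with y hy
    rw [hy, mellinExt]
    congr 3
    have : ∀ t ∈ Ioi (0 : ℝ), (Ioo (0 : ℝ) 1).indicator (fun t => f t * ((t ^ x : ℝ) : ℂ)) t *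
        (t : ℂ) ^ ((y : ℂ) * Complex.I - 1 / 2) = (Ioo (0 : ℝ) 1).indicator
          (fun t : ℝ => f t * (t : ℂ) ^ ((x : ℂ) + (y : ℂ) * Complex.I - 1 / 2)) t := by
      intro t ht
      have ht : 0 < t := ht
      have ht0 : (t : ℂ) ≠ 0 := by exact_mod_cast ht.ne'
      by_cases h : t ∈ Ioo (0 : ℝ) 1
      · simp only [indicator_of_mem h]
        rw [mul_assoc, Complex.ofReal_cpow ht.le, ← Complex.cpow_add _ _ ht0]
        congr 2
        ring
      · simp [indicator_of_notMem h]
    rw [setIntegral_congr_fun measurableSet_Ioi this, setIntegral_indicator measurableSet_Ioo,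
      inter_eq_right.2 fun t ht => ht.1]
  rw [lintegral_congr_ae h1, ← lintegral_imagAxis (fun s => ‖mellinIso (hm.toLp _) s‖ₑ ^ 2)]
  have h2 : ∫⁻ s, ‖mellinIso (hm.toLp _) s‖ₑ ^ 2 ∂imagAxis =
      eLpNorm (mellinIso (hm.toLp _)) 2 imagAxis ^ 2 := by
    rw [eLpNorm_two_eq, ← ENNReal.rpow_natCast, ← ENNReal.rpow_mul]
    norm_num
  rw [h2, ← Lp.enorm_def, mellinIso.enorm_map, Lp.enorm_toLp]
  gcongr

theorem isHardyFunction_mellinExt (f : L2One) : IsHardyFunction (mellinExt f) :=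
  ⟨differentiableOn_mellinExt f, lt_of_le_of_lt
    (iSup₂_le fun _ hx => lintegral_mellinExt_le f hx) (ENNReal.pow_lt_top (Lp.memLp f).2)⟩

/-! ### The Poisson formula for the analytic continuation -/

/-- The function whose modified Mellin transform is the Poisson kernel at `x + iβ`. -/
def poissonSource (x β t : ℝ) : ℂ :=
  (Ioc (0 : ℝ) 1).indicator (fun t : ℝ => (t : ℂ) ^ ((x : ℂ) - (β : ℂ) * Complex.I - 1 / 2)) t +
    (Ioi (1 : ℝ)).indicator
      (fun t : ℝ => (t : ℂ) ^ (-(x : ℂ) - (β : ℂ) * Complex.I - 1 / 2)) t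

theorem poissonSource_of_le {x β t : ℝ} (h0 : 0 < t) (h1 : t ≤ 1) :
    poissonSource x β t = (t : ℂ) ^ ((x : ℂ) - (β : ℂ) * Complex.I - 1 / 2) := by
  simp [poissonSource, h0, h1]

theorem poissonSource_of_gt {x β t : ℝ} (h1 : 1 < t) :
    poissonSource x β t = (t : ℂ) ^ (-(x : ℂ) - (β : ℂ) * Complex.I - 1 / 2) := by
  simp [poissonSource, h1]

theorem measurable_poissonSource (x β : ℝ) : Measurable (poissonSource x β) :=
  ((by fun_prop : Measurable fun t : ℝ =>
    (t : ℂ) ^ ((x : ℂ) - (β : ℂ) * Complex.I - 1 / 2)).indicator measurableSet_Ioc).add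
  ((by fun_prop : Measurable fun t : ℝ =>
    (t : ℂ) ^ (-(x : ℂ) - (β : ℂ) * Complex.I - 1 / 2)).indicator measurableSet_Ioi)

theorem memLp_poissonSource {x : ℝ} (hx : 0 < x) (β : ℝ) :
    MemLp (poissonSource x β) 2 (volume.restrict (Ioi (0 : ℝ))) := by
  rw [memLp_two_iff_integrable_sq_norm (measurable_poissonSource x β).aestronglyMeasurable]
  change IntegrableOn (fun t => ‖poissonSource x β t‖ ^ 2) (Ioi 0) volume
  rw [← Ioc_union_Ioi_eq_Ioi (zero_le_one' ℝ), integrableOn_union]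
  constructor
  · have h : IntegrableOn (fun t : ℝ => t ^ (2 * x - 1)) (Ioc 0 1) := by
      rw [← intervalIntegrable_iff_integrableOn_Ioc_of_le zero_le_one]
      exact intervalIntegral.intervalIntegrable_rpow' (by linarith)
    refine h.congr_fun (fun t ht => ?_) measurableSet_Ioc
    simp only
    rw [poissonSource_of_le ht.1 ht.2, Complex.norm_cpow_eq_rpow_re_of_pos ht.1,
      ← Real.rpow_natCast, ← Real.rpow_mul ht.1.le]
    congr 1
    simp
    ring
  · have h := integrableOn_Ioi_rpow_of_lt (a := -2 * x - 1) (by linarith) one_pos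
    refine h.congr_fun (fun t ht => ?_) measurableSet_Ioi
    have ht0 : 0 < t := one_pos.trans ht
    simp only
    rw [poissonSource_of_gt ht, Complex.norm_cpow_eq_rpow_re_of_pos ht0,
      ← Real.rpow_natCast, ← Real.rpow_mul ht0.le]
    congr 1
    simp
    ring

theorem integrableOn_poissonSource_Ioc {x : ℝ} (hx : 0 < x) (w : ℂ) (hw : w.re = 0) :
    IntegrableOn (fun t : ℝ => (t : ℂ) ^ ((x : ℂ) + w - 1)) (Ioc 0 1) := by
  rw [← intervalIntegrable_iff_integrableOn_Ioc_of_le zero_le_one]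
  exact intervalIntegral.intervalIntegrable_cpow' (by simp [hw, hx])

theorem integrableOn_poissonSource_Ioi {x : ℝ} (hx : 0 < x) (w : ℂ) (hw : w.re = 0) :
    IntegrableOn (fun t : ℝ => (t : ℂ) ^ (-(x : ℂ) + w - 1)) (Ioi 1) :=
  integrableOn_Ioi_cpow_of_lt (by simp [hw]; linarith) one_pos

theorem poissonSource_mul_cpow_of_le (x β y : ℝ) {t : ℝ} (ht : t ∈ Ioc (0 : ℝ) 1) :
    poissonSource x β t * (t : ℂ) ^ ((y : ℂ) * Complex.I - 1 / 2) =
      (t : ℂ) ^ ((x : ℂ) + ((y - β : ℝ) : ℂ) * Complex.I - 1) := by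
  rw [poissonSource_of_le ht.1 ht.2, ← Complex.cpow_add _ _ (by exact_mod_cast ht.1.ne')]
  congr 1
  push_cast
  ring

theorem poissonSource_mul_cpow_of_gt (x β y : ℝ) {t : ℝ} (ht : t ∈ Ioi (1 : ℝ)) :
    poissonSource x β t * (t : ℂ) ^ ((y : ℂ) * Complex.I - 1 / 2) =
      (t : ℂ) ^ (-(x : ℂ) + ((y - β : ℝ) : ℂ) * Complex.I - 1) := by
  rw [poissonSource_of_gt ht,
    ← Complex.cpow_add _ _ (by exact_mod_cast (one_pos.trans ht : (0 : ℝ) < t).ne')]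
  congr 1
  push_cast
  ring

theorem integrableOn_poissonSource {x : ℝ} (hx : 0 < x) (β y : ℝ) :
    IntegrableOn (fun t : ℝ => poissonSource x β t * (t : ℂ) ^ ((y : ℂ) * Complex.I - 1 / 2))
        (Ioc 0 1) ∧
      IntegrableOn (fun t : ℝ => poissonSource x β t * (t : ℂ) ^ ((y : ℂ) * Complex.I - 1 / 2))
        (Ioi 1) :=
  ⟨(integrableOn_poissonSource_Ioc hx (((y - β : ℝ) : ℂ) * Complex.I) (by simp)).congr_fun
    (fun _ ht => (poissonSource_mul_cpow_of_le x β y ht).symm) measurableSet_Ioc,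
  (integrableOn_poissonSource_Ioi hx (((y - β : ℝ) : ℂ) * Complex.I) (by simp)).congr_fun
    (fun _ ht => (poissonSource_mul_cpow_of_gt x β y ht).symm) measurableSet_Ioi⟩

/-- With u = y - β the pieces over (0, 1] and (1, ∞) are 1/(x + iu) and 1/(x - iu), which add up to
2x/(x² + u²). -/
theorem integral_poissonSource {x : ℝ} (hx : 0 < x) (β y : ℝ) :
    ∫ t in Ioi (0 : ℝ), poissonSource x β t * (t : ℂ) ^ ((y : ℂ) * Complex.I - 1 / 2) =
      2 * ((x / (x ^ 2 + (y - β) ^ 2) : ℝ) : ℂ) := by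
  obtain ⟨h1, h2⟩ := integrableOn_poissonSource hx β y
  rw [← Ioc_union_Ioi_eq_Ioi (zero_le_one' ℝ),
    setIntegral_union Ioc_disjoint_Ioi_same measurableSet_Ioi h1 h2,
    setIntegral_congr_fun measurableSet_Ioc fun t ht => poissonSource_mul_cpow_of_le x β y ht,
    setIntegral_congr_fun measurableSet_Ioi fun t ht => poissonSource_mul_cpow_of_gt x β y ht,
    ← intervalIntegral.integral_of_le zero_le_one, integral_cpow (Or.inl (by simp [hx])),
    integral_Ioi_cpow_of_lt (by simp; linarith) one_pos]
  set u : ℝ := y - β with hu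
  have n1 : (x : ℂ) + (u : ℂ) * Complex.I ≠ 0 := fun h => by
    have := congrArg Complex.re h
    simp at this
    exact hx.ne' this
  have n2 : -(x : ℂ) + (u : ℂ) * Complex.I ≠ 0 := fun h => by
    have := congrArg Complex.re h
    simp at this
    exact hx.ne' this
  have n3 : (x : ℂ) ^ 2 + (u : ℂ) ^ 2 ≠ 0 := by
    have : x ^ 2 + u ^ 2 ≠ 0 := by positivity
    exact_mod_cast this
  simp only [sub_add_cancel, Complex.ofReal_one, Complex.one_cpow, Complex.ofReal_zero,
    Complex.zero_cpow n1, sub_zero]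
  push_cast
  field_simp
  linear_combination (-2 * (x : ℂ) * (u : ℂ) ^ 2) * Complex.I_sq

theorem mellinIso_poissonSource {x : ℝ} (hx : 0 < x) (β : ℝ) :
    ∀ᵐ y : ℝ, mellinIso ((memLp_poissonSource hx β).toLp _) ((y : ℂ) * Complex.I) =
      ((√(2 * Real.pi) : ℝ) : ℂ)⁻¹ * (2 * ((x / (x ^ 2 + (y - β) ^ 2) : ℝ) : ℂ)) := by
  have hi : IntegrableOn (fun t : ℝ => poissonSource x β t * ((t ^ (-1 / 2 : ℝ) : ℝ) : ℂ))
      (Ioi 0) := by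
    obtain ⟨h1, h2⟩ := integrableOn_poissonSource hx β 0
    have h3 := h1.union h2
    rw [Ioc_union_Ioi_eq_Ioi (zero_le_one' ℝ)] at h3
    refine h3.congr_fun (fun t ht => ?_) measurableSet_Ioi
    simp only
    rw [Complex.ofReal_cpow (le_of_lt ht)]
    congr 2
    push_cast
    ring
  filter_upwards [ae_imagAxis_iff.1
    (mellinIso_eq_integral (memLp_poissonSource hx β).coeFn_toLp hi)] with y hy
  rw [hy, integral_poissonSource hx]

/-- On (0, 1) `poissonSource` is the conjugate of t^{x+iβ-1/2}, so its pairing with f is the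
integral defining `mellinExt`. Its values beyond 1 do not affect this pairing and only serve to make
its transform the Poisson kernel; Parseval then gives the formula. -/
theorem mellinExt_eq_poisson (f : L2One) {x : ℝ} (hx : 0 < x) (β : ℝ) :
    mellinExt f ((x : ℂ) + (β : ℂ) * Complex.I) = (Real.pi : ℂ)⁻¹ *
      ∫ y : ℝ, ((x / (x ^ 2 + (y - β) ^ 2) : ℝ) : ℂ) *
        mellinIso (extendZero f) ((y : ℂ) * Complex.I) := by
  have hp := Real.pi_pos
  set k : L2Inf := (memLp_poissonSource hx β).toLp _ with hk
  have h1 : inner ℂ k (extendZero f) =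
      ∫ t in Ioo (0 : ℝ) 1, f t * (t : ℂ) ^ ((x : ℂ) + (β : ℂ) * Complex.I - 1 / 2) := by
    rw [L2.inner_def]
    have : ∫ t in Ioi 0, inner ℂ (k t) (extendZero f t) = ∫ t in Ioi 0,
        (Ioo (0 : ℝ) 1).indicator
          (fun t : ℝ => f t * (t : ℂ) ^ ((x : ℂ) + (β : ℂ) * Complex.I - 1 / 2)) t := by
      refine integral_congr_ae ?_
      filter_upwards [(memLp_poissonSource hx β).coeFn_toLp, extendZero_ae f] with t h2 h3
      rw [hk, h2, h3]
      by_cases h : t ∈ Ioo (0 : ℝ) 1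
      · simp only [indicator_of_mem h]
        rw [poissonSource_of_le h.1 h.2.le, RCLike.inner_apply, conj_cpow_ofReal h.1]
        congr 2
        simp only [map_sub, map_mul, Complex.conj_ofReal, Complex.conj_I, map_div₀, map_one,
          map_ofNat, mul_neg, sub_neg_eq_add]
      · simp only [indicator_of_notMem h, inner_zero_right]
    rw [this, setIntegral_indicator measurableSet_Ioo, inter_eq_right.2 fun t ht => ht.1]
  rw [mellinExt, ← h1, ← mellinIso.inner_map_map, L2.inner_def, integral_imagAxis]
  have h4 : ∀ᵐ y : ℝ, inner ℂ (mellinIso k ((y : ℂ) * Complex.I))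
      (mellinIso (extendZero f) ((y : ℂ) * Complex.I)) =
      (((√(2 * Real.pi) : ℝ) : ℂ)⁻¹ * 2) * (((x / (x ^ 2 + (y - β) ^ 2) : ℝ) : ℂ) *
        mellinIso (extendZero f) ((y : ℂ) * Complex.I)) := by
    filter_upwards [mellinIso_poissonSource hx β] with y hy
    rw [hy, RCLike.inner_apply]
    simp only [map_mul, map_inv₀, Complex.conj_ofReal, map_ofNat]
    ring
  rw [integral_congr_ae h4, integral_const_mul, ← mul_assoc, ← mul_assoc]
  congr 1
  have h5 : ((√(2 * Real.pi) : ℝ) : ℂ) * ((√(2 * Real.pi) : ℝ) : ℂ) = 2 * Real.pi := by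
    rw [← Complex.ofReal_mul, Real.mul_self_sqrt (by positivity)]
    push_cast
    ring
  rw [← mul_inv, h5, mul_inv, mul_comm (2 : ℂ)⁻¹, mul_assoc, inv_mul_cancel₀ two_ne_zero, mul_one]

/-! ### The unitary from L²(0, 1) onto the Hardy space -/

theorem mellinIso_extendZero_mem_hardyPlus (f : L2One) :
    mellinIso (extendZero f) ∈ hardyPlus := by
  refine ⟨mellinExt f, isHardyFunction_mellinExt f, ?_⟩
  rw [ae_imagAxis_iff]
  have hg : MemLp (fun y : ℝ => mellinIso (extendZero f) ((y : ℂ) * Complex.I)) 2 volume :=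
    (Lp.memLp _).comp_measurePreserving measurePreserving_toImag
  filter_upwards [ae_tendsto_poisson hg] with β hβ
  refine hβ.congr' ?_
  filter_upwards [self_mem_nhdsWithin] with x hx
  rw [mellinExt_eq_poisson f hx β]

/-- The modified Mellin transform as a unitary operator from `L²(0, 1)` onto `H²₊(iℝ)`. -/
def mellinUnitIso : L2One ≃ₗᵢ[ℂ] hardyPlus :=
  LinearIsometryEquiv.ofSurjective
    { toLinearMap := ((mellinIso.toLinearIsometry.comp extendZero).toLinearMap).codRestrict
        hardyPlus mellinIso_extendZero_mem_hardyPlus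
      norm_map' := fun f => (mellinIso.toLinearIsometry.comp extendZero).norm_map f }
    fun g => by
      obtain ⟨f, hf⟩ := exists_mellinIso_extendZero_eq g.2
      exact ⟨f, Subtype.ext hf⟩

theorem coe_mellinUnitIso (f : L2One) :
    (mellinUnitIso f : L2Imag) = mellinIso (extendZero f) := rfl

theorem extendZero_sub_adjoint_hardyInf (f : L2One) :
    extendZero f - ContinuousLinearMap.adjoint hardyInf (extendZero f) =
      extendZero (f - ContinuousLinearMap.adjoint hardyOne f) := by
  rw [map_sub, adjoint_hardyInf_extendZero]

end HardyMellin

end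

theorem proposition3p5 :
    ∃ Q : HardyMellin.L2Inf ≃ₗᵢ[ℂ] HardyMellin.L2Imag,
      -- `Q` is the modified Mellin transform
      (∀ f, HardyMellin.IsMellinTransform f (Q f)) ∧
      -- `Q` carries `I - H_∞^*` on `L²(0, ∞)` to `M_φ` on `L²(iℝ)`
      (∀ f, Q (f - ContinuousLinearMap.adjoint HardyMellin.hardyInf f) =
        HardyMellin.mulPhi (Q f)) ∧
      -- `L²(0, 1)` is invariant for `I - H_∞^*`, and the restriction is `I - H_1^*`
      (∀ f : HardyMellin.L2One,
        HardyMellin.extendZero f -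
            ContinuousLinearMap.adjoint HardyMellin.hardyInf (HardyMellin.extendZero f) =
          HardyMellin.extendZero (f - ContinuousLinearMap.adjoint HardyMellin.hardyOne f)) ∧
      -- `H²₊(iℝ)` is invariant for `M_φ`
      (∀ g ∈ HardyMellin.hardyPlus, HardyMellin.mulPhi g ∈ HardyMellin.hardyPlus) ∧
      -- `Q` restricts to a unitary `L²(0, 1) → H²₊(iℝ)` carrying `I - H_1^*` to `M_φ`
      (∃ U : HardyMellin.L2One ≃ₗᵢ[ℂ] HardyMellin.hardyPlus,
        (∀ f, (U f : HardyMellin.L2Imag) = Q (HardyMellin.extendZero f)) ∧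
        (∀ f, (U (f - ContinuousLinearMap.adjoint HardyMellin.hardyOne f) :
            HardyMellin.L2Imag) = HardyMellin.mulPhi (U f))) ∧
      -- `I - H_∞` on `L²(0, ∞)` is carried to `M_φ` on `L²(iℝ)` by `f ↦ (s ↦ (Q f)(-s))`
      (∃ V : HardyMellin.L2Inf ≃ₗᵢ[ℂ] HardyMellin.L2Imag,
        (∀ f, ∀ᵐ s ∂HardyMellin.imagAxis, V f s = Q f (-s)) ∧
        (∀ f, V (f - HardyMellin.hardyInf f) = HardyMellin.mulPhi (V f))) := by
  refine ⟨HardyMellin.mellinIso, HardyMellin.isMellinTransform_mellinIso,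
    HardyMellin.mellinIso_sub_adjoint_hardyInf, HardyMellin.extendZero_sub_adjoint_hardyInf,
    fun g hg => HardyMellin.mulPhi_mem_hardyPlus hg,
    ⟨HardyMellin.mellinUnitIso, HardyMellin.coe_mellinUnitIso, fun f => ?_⟩,
    ⟨HardyMellin.mellinReflIso, HardyMellin.mellinReflIso_ae,
      HardyMellin.mellinReflIso_sub_hardyInf⟩⟩
  rw [HardyMellin.coe_mellinUnitIso, HardyMellin.coe_mellinUnitIso,
    ← HardyMellin.extendZero_sub_adjoint_hardyInf, HardyMellin.mellinIso_sub_adjoint_hardyInf]
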